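/- A partition with at most $d$ parts is written as a $d$-tuple of integers $\alpha_1\ge\dots\ge\alpha_d\ge 0$; sums and differences of $d$-tuples are taken entrywise, containment $\beta\subseteq\alpha$ means $\beta_i\le\alpha_i$ for all $i$, and $\beta^{\leftarrow}=(\beta_d,\dots,\beta_1)$. For $\ell\ge 0$ let $(\ell)^d=(\ell,\dots,\ell)$ be the rectangle with $d$ rows of length $\ell$. For partitions $\alpha,\beta,\gamma$ with at most $d$ parts, the Littlewood--Richardson number $c_{\beta\,\gamma}^{\alpha}$ is the number of semistandard skew tableaux of shape $\alpha/\beta$ and type $\gamma$ (that is, with $\gamma_i$ entries equal to $i$ for $1\le i\le d$, and no other entries) such that in every initial part of the word obtained by reading the rows from top to bottom, each from right to left, the value $i$ occurs at least as often as the value $i+1$, for $i=1,\dots,d-1$; it is $0$ if $\beta\not\subseteq\alpha$. For integer $d$-tuples that are not all partitions, $c_{\beta\,\gamma}^{\alpha}$ is $0$ by convention. **Proposition.** Let $\alpha,\beta,\gamma$ be partitions with at most $d$ parts, and let $\square_\beta=(k)^d$ and $\square^\gamma=(m)^d$, with integers $k,m\ge 0$, be rectangles such that $\square_\beta\supseteq\beta$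 and $\square^\gamma\subseteq\gamma$. Then $$c_{\alpha\,\beta}^{\gamma}=c_{(\square_\beta-\beta^{\leftarrow})\,(\gamma-\square^\gamma)}^{\alpha+\square_\beta-\square^\gamma}.$$ -/

import Mathlib

/-- A partition with at most `d` parts, written as a weakly decreasing `d`-tuple of nonnegative
integers (padded by zeros). -/
def IsPartition {d : ℕ} (K : Fin d → ℤ) : Prop :=
  Antitone K ∧ ∀ i, 0 ≤ K i

/-- The rectangle `(ℓ)^d`: `d` rows of length `ℓ`. -/
def rect (d ℓ : ℕ) : Fin d → ℤ := fun _ => (ℓ : ℤ)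

/-- The reversed tuple `(k_d, …, k_1)`. -/
def revTuple {d : ℕ} (K : Fin d → ℤ) : Fin d → ℤ := fun i => K (Fin.rev i)

/-- The box in row `i` and column `j` (columns are numbered from `1`) lies in the skew diagram
`outer / inner`. -/
def InSkew {d : ℕ} (outer inner : Fin d → ℤ) (i : Fin d) (j : ℤ) : Prop :=
  inner i < j ∧ j ≤ outer i

/-- Semistandard fillings of `outer / inner` with entries in `{1, …, d}`: weakly increasing along
rows, strictly increasing down columns. Outside the diagram, the entry is `0` by convention, so
that distinct `T` are distinct tableaux. -/
structure IsSkewSSYT {d : ℕ} (outer inner : Fin d → ℤ) (T : Fin d → ℤ → ℕ) : Prop where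
  zeros : ∀ i j, ¬ InSkew outer inner i j → T i j = 0
  entries : ∀ i j, InSkew outer inner i j → 1 ≤ T i j ∧ T i j ≤ d
  row_weak : ∀ i j j', InSkew outer inner i j → InSkew outer inner i j' →
    j ≤ j' → T i j ≤ T i j'
  col_strict : ∀ i i' j, InSkew outer inner i j → InSkew outer inner i' j →
    i < i' → T i j < T i' j

/-- The word of a filling: the rows from top to bottom, each one read from right to left
(columns `outer i`, `outer i - 1`, …, `inner i + 1`). -/
def readingWord {d : ℕ} (outer inner : Fin d → ℤ) (T : Fin d → ℤ → ℕ) : List ℕ :=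
  (List.finRange d).flatMap fun i =>
    (List.range (outer i - inner i).toNat).map fun s => T i (outer i - (s : ℤ))

/-- In every initial part of the word `w`, the letter `i` occurs at least as often as `i + 1`,
for all `i = 1, …, d - 1`. -/
def IsLatticeWord (d : ℕ) (w : List ℕ) : Prop :=
  ∀ v : List ℕ, v <+: w → ∀ i : ℕ, 1 ≤ i → i + 1 ≤ d → v.count (i + 1) ≤ v.count i

/-- `T` is a Littlewood–Richardson skew tableau of shape `outer / inner` and type `type`: the
letter `i` occurs `type_i` times (`Fin d` numbers the parts from `0`). -/
structure IsLRTableau {d : ℕ} (outer inner type : Fin d → ℤ) (T : Fin d → ℤ → ℕ) : Prop where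
  ssyt : IsSkewSSYT outer inner T
  content : ∀ i : Fin d, ((readingWord outer inner T).count (i.val + 1) : ℤ) = type i
  lattice : IsLatticeWord d (readingWord outer inner T)

open Classical in
/-- The Littlewood–Richardson number `c_{β γ}^{α}`: the number of Littlewood–Richardson skew
tableaux of shape `α / β` and type `γ`. There are none unless `α`, `β`, `γ` are partitions and the
diagram of `β` is contained in that of `α`. -/
noncomputable def lrNumber {d : ℕ} (β γ α : Fin d → ℤ) : ℕ :=
  if IsPartition α ∧ IsPartition β ∧ IsPartition γ ∧ β ≤ α then
    Nat.card {T : Fin d → ℤ → ℕ // IsLRTableau α β γ T}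
  else 0

/-- There are finitely many tableaux of a given shape and type, so the cardinality in `lrNumber`
is an honest count. -/
theorem finite_lrTableaux {d : ℕ} (outer inner type : Fin d → ℤ) :
    Finite {T : Fin d → ℤ → ℕ // IsLRTableau outer inner type T} := by
  let F : {T : Fin d → ℤ → ℕ // IsLRTableau outer inner type T} →
      (∀ i : Fin d, Set.Ioc (inner i) (outer i) → Fin (d + 1)) := fun T i j =>
    ⟨T.1 i j.1, Nat.lt_succ_of_le (T.2.ssyt.entries i j.1 j.2).2⟩
  have hF : Function.Injective F := by
    intro T T' h
    apply Subtype.ext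
    funext i j
    by_cases hj : InSkew outer inner i j
    · have h1 := congrFun (congrFun h i) ⟨j, hj⟩
      exact congrArg Fin.val h1
    · rw [T.2.ssyt.zeros i j hj, T'.2.ssyt.zeros i j hj]
  have : ∀ i : Fin d, Finite (Set.Ioc (inner i) (outer i)) := fun i =>
    (Set.finite_Ioc (inner i) (outer i)).to_subtype
  exact Finite.of_injective F hF

/-! Two symmetries of Littlewood–Richardson numbers are combined: commutativity in the lower
arguments, and a reflection of hives.

A Littlewood–Richardson tableau is recorded by the numbers of each letter in its first `i` rows.
These numbers form a Gelfand–Tsetlin pattern whose top row is the type. The lattice condition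
becomes interlacing, column strictness becomes dominance with respect to the inner shape, and the
row lengths fix the weight (`lrNumber_eq_gtCount`).

Commutativity (`gtCount_comm`) comes from alternants. In `alternant (shifted d α) * schurPoly d β`
the non-dominant patterns cancel in pairs under a Bender–Knuth toggle applied to part of the
columns, so its coefficient at `shifted d γ` is `gtCount d α β γ`. For `α = 0` a single pattern
survives, so the product with `α` is the product of the alternant at `0` with both Schur
polynomials, which is symmetric in `α` and `β`.

Partial sums turn dominant patterns into hives (`gtCount_eq_card_hives`). A reflection of the
triangle exchanges the ends of its left side and swaps its other two sides; it permutes the rhombus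
inequalities, and a linear function may be added because it turns every rhombus inequality into an
equality. After `α` and `β` are exchanged, `β` lies on the left side. The reflection reverses and
negates it and swaps `α` with `γ`, while the linear function supplies the shifts by the rectangles
(`card_hives_reflect`). -/

open Finset

/-! ### Gelfand–Tsetlin patterns, and dominance by rows and by columns. -/

/-- Gelfand–Tsetlin patterns with top row `β`, extended by `0` below the triangle and constantly by
`β` from row `d` on. -/
structure IsGTPattern (d : ℕ) (β : ℕ → ℤ) (x : ℕ → ℕ → ℤ) : Prop where
  zero : ∀ j, x 0 j = 0
  top : ∀ i, d ≤ i → ∀ j, x i j = β j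
  le_succ : ∀ i j, x i j ≤ x (i + 1) j
  succ_le : ∀ i j, x (i + 1) (j + 1) ≤ x i j

/-- The sum of the first `d` entries of row `i`. -/
def rowSum (d : ℕ) (x : ℕ → ℕ → ℤ) (i : ℕ) : ℤ := ∑ j ∈ range d, x i j

/-- The weight of a Gelfand–Tsetlin pattern: the differences of consecutive row sums. -/
def gtWeight (d : ℕ) (x : ℕ → ℕ → ℤ) : Fin d → ℤ := fun i => rowSum d x (i + 1) - rowSum d x i

/-- `α`-dominance of a pattern, in terms of the rows of the corresponding tableau. -/
def RowDominant (d : ℕ) (α : ℕ → ℤ) (x : ℕ → ℕ → ℤ) : Prop :=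
  ∀ i, i + 1 < d → ∀ k, α (i + 1) + ∑ j ∈ range (k + 1), (x (i + 2) j - x (i + 1) j) ≤
    α i + ∑ j ∈ range k, (x (i + 1) j - x i j)

/-- The part of an integer exceeding the cut `C`. -/
def posAbove (C v : ℤ) : ℤ := max (v - C) 0

/-- In the columns to the right of `C` of the tableau of `x`, the number of letters `i + 1` minus the
number of letters `i` (letters are numbered from `0`). -/
def excess (d : ℕ) (x : ℕ → ℕ → ℤ) (i : ℕ) (C : ℤ) : ℤ :=
  ∑ j ∈ range d, (posAbove C (x (i + 2) j) - 2 * posAbove C (x (i + 1) j) + posAbove C (x i j))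

/-- `α`-dominance fails at the letters `i`, `i + 1` for the columns to the right of `C`. -/
def DominanceFails (d : ℕ) (α : ℕ → ℤ) (x : ℕ → ℕ → ℤ) (C : ℕ) (i : ℕ) : Prop :=
  i + 1 < d ∧ α i - α (i + 1) < excess d x i C

theorem posAbove_of_le {C v : ℤ} (h : v ≤ C) : posAbove C v = 0 := by
  unfold posAbove; omega

theorem posAbove_of_ge {C v : ℤ} (h : C ≤ v) : posAbove C v = v - C := by
  unfold posAbove; omega

namespace IsGTPattern

variable {d : ℕ} {β : ℕ → ℤ} {x : ℕ → ℕ → ℤ}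

theorem nonneg (h : IsGTPattern d β x) (i j : ℕ) : 0 ≤ x i j := by
  induction i with
  | zero => rw [h.zero]
  | succ i ih => exact ih.trans (h.le_succ i j)

theorem eq_zero (h : IsGTPattern d β x) {i j : ℕ} (hij : i ≤ j) : x i j = 0 := by
  induction i generalizing j with
  | zero => exact h.zero j
  | succ i ih =>
    obtain ⟨j, rfl⟩ : ∃ j', j = j' + 1 := ⟨j - 1, by omega⟩
    have := ih (j := j) (by omega)
    exact le_antisymm (this ▸ h.succ_le i j) (h.nonneg _ _)

theorem mono (h : IsGTPattern d β x) (j : ℕ) : Monotone fun i => x i j :=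
  monotone_nat_of_le_succ fun i => h.le_succ i j

theorem le_top (h : IsGTPattern d β x) (i j : ℕ) : x i j ≤ β j := by
  rw [← h.top (max i d) (le_max_right _ _) j]
  exact h.mono j (le_max_left _ _)

theorem eq_zero_of_le (h : IsGTPattern d β x) (i : ℕ) {j : ℕ} (hj : d ≤ j) : x i j = 0 := by
  refine le_antisymm ?_ (h.nonneg i j)
  rw [← h.eq_zero hj, h.top d le_rfl]
  exact h.le_top i j

theorem antitone (h : IsGTPattern d β x) (i : ℕ) : Antitone (x i) :=
  antitone_nat_of_succ_le fun j => (h.le_succ i (j + 1)).trans (h.succ_le i j)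

theorem le_bound (h : IsGTPattern d β x) (i j : ℕ) : x i j ≤ β 0 :=
  (h.antitone i (Nat.zero_le j)).trans (h.le_top i 0)

theorem sum_range_eq {F : ℕ → ℤ} {a b : ℕ} (ha : ∀ j, a ≤ j → F j = 0) (hb : ∀ j, b ≤ j → F j = 0) :
    ∑ j ∈ range a, F j = ∑ j ∈ range b, F j := by
  rw [← Finset.eventually_constant_sum ha (le_max_left a b),
    ← Finset.eventually_constant_sum hb (le_max_right a b)]

theorem excess_eq_sum (h : IsGTPattern d β x) (i k : ℕ) {C : ℤ} (hC : 0 ≤ C)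
    (hk : x (i + 2) (k + 1) ≤ C) :
    excess d x i C = ∑ j ∈ range (k + 1),
      (posAbove C (x (i + 2) j) - 2 * posAbove C (x (i + 1) j) + posAbove C (x i j)) := by
  refine sum_range_eq (fun j hj => ?_) (fun j hj => ?_)
  · simp [h.eq_zero_of_le _ hj, posAbove_of_le hC]
  · have h2 := (h.antitone (i + 2) hj).trans hk
    have h1 := (h.le_succ (i + 1) j).trans h2
    have h0 := (h.le_succ i j).trans h1
    simp [posAbove_of_le h2, posAbove_of_le h1, posAbove_of_le h0]

/-- Interlacing places the entries before `k` of all three rows at or above the cut `x (i + 1) k`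
and those after `k` at or below it, so the truncations disappear. Dominance by rows is thus
dominance by columns at these special cuts. -/
theorem excess_eq (h : IsGTPattern d β x) (i k : ℕ) :
    excess d x i (x (i + 1) k) = ∑ j ∈ range (k + 1), (x (i + 2) j - x (i + 1) j) -
      ∑ j ∈ range k, (x (i + 1) j - x i j) := by
  rw [h.excess_eq_sum i k (h.nonneg _ _) (h.succ_le _ _), sum_range_succ, sum_range_succ,
    posAbove_of_ge (h.le_succ (i + 1) k), posAbove_of_ge le_rfl, posAbove_of_le (h.le_succ i k)]
  have : ∀ j ∈ range k, posAbove (x (i + 1) k) (x (i + 2) j) -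
      2 * posAbove (x (i + 1) k) (x (i + 1) j) + posAbove (x (i + 1) k) (x i j) =
      (x (i + 2) j - x (i + 1) j) - (x (i + 1) j - x i j) := by
    intro j hj
    have hj := mem_range.1 hj
    have h1 := h.antitone (i + 1) hj.le
    have h0 := (h.antitone (i + 1) (Nat.succ_le_of_lt hj)).trans (h.succ_le i j)
    rw [posAbove_of_ge h1, posAbove_of_ge (h1.trans (h.le_succ (i + 1) j)), posAbove_of_ge h0]
    ring
  rw [sum_congr rfl this, sum_sub_distrib]
  ring

/-- An arbitrary cut is controlled by the last index `k` at which row `i + 2` exceeds it. Two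
interlacing steps show that all three rows exceed `C` at every index up to `k - 2`, so only the
indices `k - 1` and `k` need a case check. -/
theorem excess_le (h : IsGTPattern d β x) (i k : ℕ) {C : ℤ} (hC : 0 ≤ C)
    (hk : x (i + 2) (k + 1) ≤ C) (hk' : C < x (i + 2) k) :
    excess d x i C ≤ ∑ j ∈ range (k + 1), (x (i + 2) j - x (i + 1) j) -
      ∑ j ∈ range k, (x (i + 1) j - x i j) := by
  rw [h.excess_eq_sum i k hC hk]
  have key : ∀ n, n < k → ∀ j ∈ range n, posAbove C (x (i + 2) j) -
      2 * posAbove C (x (i + 1) j) + posAbove C (x i j) =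
      (x (i + 2) j - x (i + 1) j) - (x (i + 1) j - x i j) := by
    intro n hn j hj
    have hj := mem_range.1 hj
    have h2 := h.antitone (i + 2) (show j + 2 ≤ k by omega)
    have h3 := h.succ_le i j
    have h4 := h.succ_le (i + 1) (j + 1)
    have h5 := h.le_succ i j
    have h6 := h.le_succ (i + 1) j
    simp only [add_assoc, Nat.reduceAdd] at *
    unfold posAbove
    omega
  have e5 := h.le_succ i k
  have e6 := h.le_succ (i + 1) k
  rcases k with _ | n
  · simp only [zero_add, sum_range_one, sum_range_zero, sub_zero]
    simp only [add_assoc, Nat.reduceAdd] at *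
    unfold posAbove
    omega
  · rw [sum_range_succ, sum_range_succ, sum_congr rfl (key n (by omega)), sum_sub_distrib,
      sum_range_succ (fun j => x (i + 2) j - x (i + 1) j),
      sum_range_succ (fun j => x (i + 2) j - x (i + 1) j),
      sum_range_succ (fun j => x (i + 1) j - x i j)]
    have h3 := h.succ_le i n
    have h4 := h.succ_le (i + 1) n
    have h5 := h.le_succ i n
    have h6 := h.le_succ (i + 1) n
    simp only [add_assoc, Nat.reduceAdd] at *
    unfold posAbove
    omega

theorem excess_eq_zero (h : IsGTPattern d β x) (i : ℕ) {C : ℤ} (hC : β 0 ≤ C) :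
    excess d x i C = 0 :=
  sum_eq_zero fun j _ => by
    simp [posAbove_of_le ((h.le_bound _ j).trans hC)]

/-- The row form is what tableaux and hives provide; the column form is what the cancellation needs.
-/
theorem rowDominant_iff (h : IsGTPattern d β x) {α : ℕ → ℤ} (hα : Antitone α) :
    RowDominant d α x ↔ ∀ C i, ¬ DominanceFails d α x C i := by
  constructor
  · rintro hr C i ⟨hi, hf⟩
    have hα' := hα (Nat.le_succ i)
    rw [Nat.succ_eq_add_one] at hα'
    by_cases h0 : x (i + 2) 0 ≤ C
    · have : excess d x i C = 0 := sum_eq_zero fun j _ => by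
        have h2 := (h.antitone (i + 2) (Nat.zero_le j)).trans h0
        have h1 := (h.le_succ (i + 1) j).trans h2
        have h0 := (h.le_succ i j).trans h1
        simp [posAbove_of_le h2, posAbove_of_le h1, posAbove_of_le h0]
      omega
    · obtain ⟨k, hk, hk'⟩ : ∃ k, x (i + 2) (k + 1) ≤ C ∧ (C : ℤ) < x (i + 2) k := by
        by_contra! hcon
        have : ∀ n, (C : ℤ) < x (i + 2) n := by
          intro n
          induction n with
          | zero => exact not_le.1 h0
          | succ n ih =>
            by_contra hn
            exact absurd (hcon n (not_lt.1 hn)) (not_le.2 ih)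
        have h1 := this d
        rw [h.eq_zero_of_le _ le_rfl] at h1
        omega
      have h1 := h.excess_le i k (Nat.cast_nonneg C) hk hk'
      have h2 := hr i hi k
      omega
  · intro hc i hi k
    have h1 := hc (x (i + 1) k).toNat i
    simp only [DominanceFails, not_and, not_lt, Int.toNat_of_nonneg (h.nonneg _ _)] at h1
    have h1 := h1 hi
    rw [h.excess_eq] at h1
    omega

end IsGTPattern

/-! ### Bender–Knuth toggles restricted to the columns up to a cut. -/

/-- The largest value that entry `j` of a row can take below the row `p` and above the row `q`. -/
def upperBound (p q : ℕ → ℤ) : ℕ → ℤ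
  | 0 => p 0
  | j + 1 => min (p (j + 1)) (q j)

/-- The Bender–Knuth toggle of the row `x` between the rows `p` and `q`, applied to the truncations
at `C` of the three rows. -/
def toggleRow (C : ℤ) (p x q : ℕ → ℤ) (j : ℕ) : ℤ :=
  x j + min C (upperBound p q j) + max (min C (p (j + 1))) (min C (q j)) - 2 * min C (x j)

/-- The Bender–Knuth toggle of row `i + 1` of a pattern, restricted to the columns up to `C`. -/
def toggle (C : ℤ) (i : ℕ) (x : ℕ → ℕ → ℤ) : ℕ → ℕ → ℤ := fun r =>
  if r = i + 1 then toggleRow C (x (i + 2)) (x (i + 1)) (x i) else x r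

theorem toggle_self (C : ℤ) (i : ℕ) (x : ℕ → ℕ → ℤ) :
    toggle C i x (i + 1) = toggleRow C (x (i + 2)) (x (i + 1)) (x i) := if_pos rfl

theorem toggle_of_ne (C : ℤ) {i r : ℕ} (hr : r ≠ i + 1) (x : ℕ → ℕ → ℤ) :
    toggle C i x r = x r := if_neg hr

/-- The minimum of `p (j + 1)` and `q j` occurs in the upper bound at `j + 1`, their maximum in the
lower bound at `j`. Together they give a plain sum, so only a boundary term remains. -/
theorem sum_upperBound_add_max (p q : ℕ → ℤ) (C : ℤ) (n : ℕ) :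
    ∑ j ∈ range (n + 1), (min C (upperBound p q j) + max (min C (p (j + 1))) (min C (q j))) =
      ∑ j ∈ range (n + 1), (min C (p j) + min C (q j)) +
        max (min C (p (n + 1))) (min C (q n)) - min C (q n) := by
  induction n with
  | zero => simp [upperBound]; ring
  | succ n ih =>
    rw [sum_range_succ, ih, sum_range_succ _ (n + 1)]
    simp only [upperBound]
    omega

namespace IsGTPattern

variable {d : ℕ} {β : ℕ → ℤ} {x : ℕ → ℕ → ℤ} {C : ℤ} {i : ℕ}

theorem le_upperBound (h : IsGTPattern d β x) (i j : ℕ) :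
    x (i + 1) j ≤ upperBound (x (i + 2)) (x i) j := by
  rcases j with _ | j
  · exact h.le_succ _ _
  · exact le_min (h.le_succ _ _) (h.succ_le _ _)

/-- The condition `hcol` says that no row of the tableau has the letter `i` in both of the columns
`C` and `C + 1`. This lets the columns up to `C` be toggled without spoiling the rows that cross the
cut. -/
theorem toggleRow_of_gt (h : IsGTPattern d β x) (hcol : ∀ j, C < x (i + 1) j → C ≤ x i j) {j : ℕ}
    (hj : C < x (i + 1) j) : toggleRow C (x (i + 2)) (x (i + 1)) (x i) j = x (i + 1) j := by
  have h1 := h.le_upperBound i j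
  have h2 := hcol j hj
  unfold toggleRow
  omega

theorem toggleRow_of_le (h : IsGTPattern d β x) {j : ℕ} (hj : x (i + 1) j ≤ C) :
    toggleRow C (x (i + 2)) (x (i + 1)) (x i) j =
      min C (upperBound (x (i + 2)) (x i) j) + max (x (i + 2) (j + 1)) (x i j) - x (i + 1) j := by
  have h1 := h.succ_le (i + 1) j
  have h2 := h.le_succ i j
  simp only [add_assoc, Nat.reduceAdd] at *
  unfold toggleRow
  omega

theorem toggleRow_bounds (h : IsGTPattern d β x) (hcol : ∀ j, C < x (i + 1) j → C ≤ x i j)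
    (j : ℕ) : x (i + 2) (j + 1) ≤ toggleRow C (x (i + 2)) (x (i + 1)) (x i) j ∧
      x i j ≤ toggleRow C (x (i + 2)) (x (i + 1)) (x i) j ∧
      toggleRow C (x (i + 2)) (x (i + 1)) (x i) j ≤ upperBound (x (i + 2)) (x i) j ∧
      (x (i + 1) j ≤ C → toggleRow C (x (i + 2)) (x (i + 1)) (x i) j ≤ C) := by
  have h1 := h.succ_le (i + 1) j
  have h2 := h.le_succ i j
  have h3 := h.le_upperBound i j
  simp only [add_assoc, Nat.reduceAdd] at *
  rcases lt_or_ge C (x (i + 1) j) with hj | hj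
  · rw [h.toggleRow_of_gt hcol hj]
    omega
  · rw [h.toggleRow_of_le hj]
    omega

theorem upperBound_le_left (p q : ℕ → ℤ) (j : ℕ) : upperBound p q j ≤ p j := by
  rcases j with _ | j
  · exact le_rfl
  · exact min_le_left _ _

theorem isGTPattern_toggle (h : IsGTPattern d β x) (hi : i + 1 < d)
    (hcol : ∀ j, C < x (i + 1) j → C ≤ x i j) : IsGTPattern d β (toggle C i x) where
  zero j := by rw [toggle_of_ne C (by omega), h.zero]
  top r hr j := by rw [toggle_of_ne C (by omega), h.top r hr]
  le_succ r j := by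
    by_cases h1 : r = i + 1
    · subst h1
      rw [toggle_self, toggle_of_ne C (by omega)]
      exact (h.toggleRow_bounds hcol j).2.2.1.trans (upperBound_le_left _ _ _)
    · rw [toggle_of_ne C h1]
      by_cases h2 : r = i
      · subst h2
        rw [toggle_self]
        exact (h.toggleRow_bounds hcol j).2.1
      · rw [toggle_of_ne C (by omega)]
        exact h.le_succ r j
  succ_le r j := by
    by_cases h1 : r = i + 1
    · subst h1
      rw [toggle_self, toggle_of_ne C (by omega)]
      exact (h.toggleRow_bounds hcol j).1
    · rw [toggle_of_ne C h1]
      by_cases h2 : r = i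
      · subst h2
        rw [toggle_self]
        exact (h.toggleRow_bounds hcol (j + 1)).2.2.1.trans (min_le_right _ _)
      · rw [toggle_of_ne C (by omega)]
        exact h.succ_le r j

theorem lt_toggle_iff (h : IsGTPattern d β x) (hcol : ∀ j, C < x (i + 1) j → C ≤ x i j) (j : ℕ) :
    C < toggle C i x (i + 1) j ↔ C < x (i + 1) j := by
  rw [toggle_self]
  constructor
  · intro h1
    by_contra h2
    exact absurd ((h.toggleRow_bounds hcol j).2.2.2 (not_lt.1 h2)) (not_le.2 h1)
  · intro h1
    rwa [h.toggleRow_of_gt hcol h1]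

theorem toggle_col (h : IsGTPattern d β x) (hcol : ∀ j, C < x (i + 1) j → C ≤ x i j) (j : ℕ)
    (hj : C < toggle C i x (i + 1) j) : C ≤ toggle C i x i j := by
  rw [toggle_of_ne C (by omega)]
  exact hcol j ((h.lt_toggle_iff hcol j).1 hj)

theorem toggle_toggle (h : IsGTPattern d β x) (hi : i + 1 < d)
    (hcol : ∀ j, C < x (i + 1) j → C ≤ x i j) :
    toggle C i (toggle C i x) = x := by
  funext r
  by_cases hr : r = i + 1
  · subst hr
    funext j
    have h' := h.isGTPattern_toggle hi hcol
    rw [toggle_self]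
    rcases lt_or_ge C (x (i + 1) j) with hj | hj
    · rw [h'.toggleRow_of_gt (h.toggle_col hcol) ((h.lt_toggle_iff hcol j).2 hj), toggle_self,
        h.toggleRow_of_gt hcol hj]
    · rw [h'.toggleRow_of_le (not_lt.1 fun hn => not_lt.2 hj ((h.lt_toggle_iff hcol j).1 hn)),
        toggle_self, toggle_of_ne C (by omega), toggle_of_ne C (by omega), h.toggleRow_of_le hj]
      ring
  · rw [toggle_of_ne C hr, toggle_of_ne C hr]

theorem posAbove_toggle (h : IsGTPattern d β x) (hcol : ∀ j, C < x (i + 1) j → C ≤ x i j) {D : ℤ}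
    (hD : C ≤ D) (r j : ℕ) : posAbove D (toggle C i x r j) = posAbove D (x r j) := by
  by_cases hr : r = i + 1
  · subst hr
    rw [toggle_self]
    rcases lt_or_ge C (x (i + 1) j) with hj | hj
    · rw [h.toggleRow_of_gt hcol hj]
    · rw [posAbove_of_le (hj.trans hD),
        posAbove_of_le (((h.toggleRow_bounds hcol j).2.2.2 hj).trans hD)]
  · rw [toggle_of_ne C hr]

theorem excess_toggle (h : IsGTPattern d β x) (hcol : ∀ j, C < x (i + 1) j → C ≤ x i j) {D : ℤ}
    (hD : C ≤ D) (r : ℕ) : excess d (toggle C i x) r D = excess d x r D := by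
  simp only [excess, h.posAbove_toggle hcol hD]

/-- The numbers of letters `i` and `i + 1` are exchanged in the columns up to `C` only; the excess
corrects for the columns that stay as they are. -/
theorem rowSum_toggle (h : IsGTPattern d β x) (hi : i + 1 < d) (hC : 0 ≤ C) :
    rowSum d (toggle C i x) (i + 1) =
      rowSum d x (i + 2) + rowSum d x i - rowSum d x (i + 1) - excess d x i C := by
  obtain ⟨n, rfl⟩ : ∃ n, d = n + 1 := ⟨d - 1, by omega⟩
  have h1 := sum_upperBound_add_max (x (i + 2)) (x i) C n
  have h2 : max (min C (x (i + 2) (n + 1))) (min C (x i n)) = min C (x i n) := by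
    have := h.nonneg i n
    rw [h.eq_zero_of_le (i + 2) le_rfl]
    omega
  rw [h2, add_sub_cancel_right] at h1
  have h3 : ∀ j, posAbove C (x (i + 2) j) - 2 * posAbove C (x (i + 1) j) + posAbove C (x i j) =
      x (i + 2) j + x i j - 2 * x (i + 1) j + 2 * min C (x (i + 1) j) -
        (min C (x (i + 2) j) + min C (x i j)) := by
    intro j
    unfold posAbove
    omega
  rw [rowSum, toggle_self, excess, sum_congr rfl fun j _ => h3 j, sum_sub_distrib, ← h1]
  simp only [toggleRow, rowSum, sum_sub_distrib, sum_add_distrib, ← mul_sum]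
  ring

/-- The left side is the contribution of column `C + 1`. The sum on the right counts its letters
`i`, and interlacing allows it at most one letter `i + 1`. -/
theorem excess_sub_le (h : IsGTPattern d β x) (i : ℕ) (C : ℤ) :
    excess d x i C - excess d x i (C + 1) ≤ 1 - ∑ j ∈ range d,
      ((posAbove C (x (i + 1) j) - posAbove (C + 1) (x (i + 1) j)) -
        (posAbove C (x i j) - posAbove (C + 1) (x i j))) := by
  rcases d with _ | n
  · simp [excess]
  have key : ∑ j ∈ range (n + 1), (posAbove C (x (i + 2) j) - posAbove (C + 1) (x (i + 2) j)) ≤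
      ∑ j ∈ range (n + 1), (posAbove C (x (i + 1) j) - posAbove (C + 1) (x (i + 1) j)) + 1 := by
    rw [sum_range_succ', sum_range_succ]
    have h1 : ∑ j ∈ range n,
          (posAbove C (x (i + 2) (j + 1)) - posAbove (C + 1) (x (i + 2) (j + 1))) ≤
        ∑ j ∈ range n, (posAbove C (x (i + 1) j) - posAbove (C + 1) (x (i + 1) j)) :=
      sum_le_sum fun j _ => by
        have := h.succ_le (i + 1) j
        simp only [add_assoc, Nat.reduceAdd] at this
        unfold posAbove
        omega
    have h2 : posAbove C (x (i + 2) 0) - posAbove (C + 1) (x (i + 2) 0) ≤ 1 := by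
      unfold posAbove; omega
    have h3 : 0 ≤ posAbove C (x (i + 1) n) - posAbove (C + 1) (x (i + 1) n) := by
      unfold posAbove; omega
    linarith
  simp only [excess, sum_sub_distrib, sum_add_distrib, ← mul_sum] at key ⊢
  linarith

/-- Including column `C + 1` pushes the excess past the threshold, while it can add at most `1`,
less the number of letters `i` there. So the threshold is passed by exactly one and the column has
no letter `i`, which gives the condition under which toggling is allowed. -/
theorem fails_last (h : IsGTPattern d β x) {α : ℕ → ℤ} {C : ℕ}
    (hf : DominanceFails d α x C i) (hl : ¬ DominanceFails d α x (C + 1) i) :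
    excess d x i C = α i - α (i + 1) + 1 ∧ ∀ j, (C : ℤ) < x (i + 1) j → (C : ℤ) ≤ x i j := by
  have h1 := h.excess_sub_le i C
  have hf' := hf.2
  simp only [DominanceFails, hf.1, true_and, not_lt, Nat.cast_add, Nat.cast_one] at hl
  have hpos : ∀ j ∈ range d, 0 ≤
      ((posAbove C (x (i + 1) j) - posAbove (C + 1) (x (i + 1) j)) -
        (posAbove C (x i j) - posAbove (C + 1) (x i j))) := fun j _ => by
    have := h.le_succ i j
    unfold posAbove
    omega
  have hs := sum_nonneg hpos
  refine ⟨by omega, fun j hj => ?_⟩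
  have hjd : j < d := by
    by_contra hjd
    rw [h.eq_zero_of_le _ (not_lt.1 hjd)] at hj
    omega
  have h0 := (sum_eq_zero_iff_of_nonneg hpos).1 (by omega) j (mem_range.2 hjd)
  unfold posAbove at h0
  omega

end IsGTPattern

/-! ### The sign-reversing pairing of non-dominant patterns. -/

/-- `C` is the last column at which dominance fails, and `i` the first letter at which it does. -/
structure IsFirstFailure (d : ℕ) (α : ℕ → ℤ) (x : ℕ → ℕ → ℤ) (C i : ℕ) : Prop where
  fails : DominanceFails d α x C i
  last : ∀ C', C < C' → ∀ i', ¬ DominanceFails d α x C' i'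
  first : ∀ i', i' < i → ¬ DominanceFails d α x C i'

theorem IsFirstFailure.unique {d : ℕ} {α : ℕ → ℤ} {x : ℕ → ℕ → ℤ} {C i C' i' : ℕ}
    (h : IsFirstFailure d α x C i) (h' : IsFirstFailure d α x C' i') : C = C' ∧ i = i' := by
  have hC : C = C' := by
    rcases lt_trichotomy C C' with hlt | heq | hgt
    · exact absurd h'.fails (h.last _ hlt _)
    · exact heq
    · exact absurd h.fails (h'.last _ hgt _)
  subst hC
  refine ⟨rfl, ?_⟩
  rcases lt_trichotomy i i' with hlt | heq | hgt
  · exact absurd h.fails (h'.first _ hlt)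
  · exact heq
  · exact absurd h'.fails (h.first _ hgt)

theorem IsGTPattern.exists_isFirstFailure {d : ℕ} {α β : ℕ → ℤ} {x : ℕ → ℕ → ℤ}
    (h : IsGTPattern d β x) (hα : Antitone α) (hx : ¬ RowDominant d α x) :
    ∃ C i, IsFirstFailure d α x C i := by
  classical
  rw [h.rowDominant_iff hα] at hx
  push Not at hx
  obtain ⟨C₀, i₀, h₀⟩ := hx
  have hbound : ∀ C : ℕ, (∃ i, DominanceFails d α x C i) → C ≤ (β 0).toNat := by
    rintro C ⟨i, hi, hf⟩
    by_contra hC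
    rw [h.excess_eq_zero i (by omega)] at hf
    have := hα (Nat.le_succ i)
    rw [Nat.succ_eq_add_one] at this
    omega
  let P : ℕ → Prop := fun C => ∃ i, DominanceFails d α x C i
  have hP : P (Nat.findGreatest P (β 0).toNat) := Nat.findGreatest_spec (hbound C₀ ⟨i₀, h₀⟩) ⟨i₀, h₀⟩
  refine ⟨Nat.findGreatest P (β 0).toNat, Nat.find hP, Nat.find_spec hP, fun C' hC' i' hf => ?_,
    fun i' hi' => Nat.find_min hP hi'⟩
  exact absurd (Nat.le_findGreatest (P := P) (hbound C' ⟨i', hf⟩) ⟨i', hf⟩) (not_le.2 hC')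

/-- The toggle at the first failure of dominance cancels non-dominant patterns in pairs. -/
theorem IsGTPattern.isFirstFailure_toggle {d : ℕ} {α β : ℕ → ℤ} {x : ℕ → ℕ → ℤ} {C i : ℕ}
    (h : IsGTPattern d β x) (hf : IsFirstFailure d α x C i) :
    IsGTPattern d β (toggle C i x) ∧ IsFirstFailure d α (toggle C i x) C i ∧
      toggle C i (toggle C i x) = x ∧
      rowSum d (toggle C i x) (i + 1) = rowSum d x (i + 2) + rowSum d x i - rowSum d x (i + 1) -
        (α i - α (i + 1) + 1) := by
  obtain ⟨h1, hcol⟩ := h.fails_last hf.fails (hf.last _ (Nat.lt_succ_self C) i)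
  -- The columns to the right of `C` are untouched, so failures at cuts from `C` on are the same for
  -- every letter. Hence the toggled pattern has the same first failure, and the pairing is an
  -- involution.
  have hiff : ∀ C' i', C ≤ C' →
      (DominanceFails d α (toggle C i x) C' i' ↔ DominanceFails d α x C' i') := by
    intro C' i' hC'
    rw [DominanceFails, h.excess_toggle hcol (Nat.cast_le.2 hC'), DominanceFails]
  refine ⟨h.isGTPattern_toggle hf.fails.1 hcol, ⟨(hiff _ _ le_rfl).2 hf.fails, fun C' hC' i' => ?_,
    fun i' hi' => ?_⟩, h.toggle_toggle hf.fails.1 hcol, ?_⟩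
  · rw [hiff _ _ hC'.le]
    exact hf.last C' hC' i'
  · rw [hiff _ _ le_rfl]
    exact hf.first i' hi'
  · rw [h.rowSum_toggle hf.fails.1 (Nat.cast_nonneg C), h1]

/-! ### Schur polynomials, alternants and their product. -/

theorem finite_gtPatterns (d : ℕ) (β : ℕ → ℤ) : {x | IsGTPattern d β x}.Finite := by
  let F : (ℕ → ℕ → ℤ) → (Fin d → Fin d → ℤ) := fun x i j => x i j
  refine Set.Finite.of_finite_image (f := F) ?_ ?_
  · refine (Set.Finite.pi' fun _ : Fin d => Set.Finite.pi' fun _ : Fin d =>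
      Set.finite_Icc (0 : ℤ) (β 0)).subset ?_
    rintro _ ⟨x, hx, rfl⟩ i j
    exact ⟨hx.nonneg _ _, hx.le_bound _ _⟩
  · intro x hx y hy hxy
    funext i j
    by_cases hi : i < d
    · by_cases hj : j < d
      · exact congrFun (congrFun hxy ⟨i, hi⟩) ⟨j, hj⟩
      · rw [IsGTPattern.eq_zero_of_le hx i (not_lt.1 hj), IsGTPattern.eq_zero_of_le hy i (not_lt.1 hj)]
    · rw [IsGTPattern.top hx i (not_lt.1 hi), IsGTPattern.top hy i (not_lt.1 hi)]

/-- The finite set of Gelfand–Tsetlin patterns with top row `β`. -/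
noncomputable def gtPatterns (d : ℕ) (β : ℕ → ℤ) : Finset (ℕ → ℕ → ℤ) :=
  (finite_gtPatterns d β).toFinset

theorem mem_gtPatterns {d : ℕ} {β : ℕ → ℤ} {x : ℕ → ℕ → ℤ} :
    x ∈ gtPatterns d β ↔ IsGTPattern d β x := by
  simp [gtPatterns]

/-- The alternant with exponent `v`, an antisymmetric Laurent polynomial. -/
noncomputable def alternant {d : ℕ} (v : Fin d → ℤ) : AddMonoidAlgebra ℤ (Fin d → ℤ) :=
  ∑ σ : Equiv.Perm (Fin d), AddMonoidAlgebra.single (v ∘ σ) (Equiv.Perm.sign σ : ℤ)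

/-- The Schur polynomial of `β` in `d` variables. -/
noncomputable def schurPoly (d : ℕ) (β : ℕ → ℤ) : AddMonoidAlgebra ℤ (Fin d → ℤ) :=
  ∑ x ∈ gtPatterns d β, AddMonoidAlgebra.single (gtWeight d x) 1

/-- The tuple `v`, shifted to `v₀, v₁ - 1, …`. -/
def shifted (d : ℕ) (v : ℕ → ℤ) : Fin d → ℤ := fun i => v i - i

theorem alternant_comp_swap {d : ℕ} (v : Fin d → ℤ) {i j : Fin d} (hij : i ≠ j) :
    alternant (v ∘ Equiv.swap i j) = - alternant v := by
  unfold alternant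
  rw [← sum_neg_distrib]
  refine Fintype.sum_equiv (Equiv.mulLeft (Equiv.swap i j)) _ _ fun σ => ?_
  simp only [Equiv.coe_mulLeft, Equiv.Perm.sign_mul, Equiv.Perm.sign_swap hij,
    ← AddMonoidAlgebra.single_neg]
  congr 1
  simp

/-- Changing row `i + 1` alone affects only two consecutive weights. The offset `v` is `0` for the
symmetry of Schur polynomials and `shifted d α` for the cancellation. -/
theorem gtWeight_add_comp_swap {d : ℕ} {x x' : ℕ → ℕ → ℤ} {i : ℕ} (hi : i + 1 < d)
    (hne : ∀ r, r ≠ i + 1 → x' r = x r) {v : Fin d → ℤ}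
    (hs : rowSum d x' (i + 1) = rowSum d x (i + 2) + rowSum d x i - rowSum d x (i + 1) -
      (v ⟨i, by omega⟩ - v ⟨i + 1, hi⟩)) :
    v + gtWeight d x' = (v + gtWeight d x) ∘ Equiv.swap ⟨i, by omega⟩ ⟨i + 1, hi⟩ := by
  have hS : ∀ r, r ≠ i + 1 → rowSum d x' r = rowSum d x r := fun r hr => by
    simp only [rowSum, hne r hr]
  funext r
  simp only [Pi.add_apply, Function.comp_apply, gtWeight]
  by_cases h1 : r = ⟨i, by omega⟩
  · subst h1
    rw [Equiv.swap_apply_left, hs, hS _ (by simp)]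
    simp only
    ring
  · by_cases h2 : r = ⟨i + 1, hi⟩
    · subst h2
      rw [Equiv.swap_apply_right, hs, hS _ (by simp)]
      simp only
      ring
    · rw [Equiv.swap_apply_of_ne_of_ne h1 h2, hS, hS]
      · exact fun h => h2 (Fin.ext h)
      · exact fun h => h1 (Fin.ext (Nat.succ_injective h))

theorem sum_gtWeight_comp_swap {M : Type*} [AddCommMonoid M] {d : ℕ} (β : ℕ → ℤ)
    (F : (Fin d → ℤ) → M) {i : ℕ} (hi : i + 1 < d) :
    ∑ x ∈ gtPatterns d β, F (gtWeight d x ∘ Equiv.swap ⟨i, by omega⟩ ⟨i + 1, hi⟩) =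
      ∑ x ∈ gtPatterns d β, F (gtWeight d x) := by
  -- No column lies beyond the cut `β 0`, so this is the full Bender–Knuth involution and the
  -- condition at the cut is vacuous.
  have hcol : ∀ x, IsGTPattern d β x → ∀ j, β 0 < x (i + 1) j → β 0 ≤ x i j := fun x hx j hj =>
    absurd hj (not_lt.2 (hx.le_bound _ _))
  refine sum_nbij' (toggle (β 0) i) (toggle (β 0) i) ?_ ?_ ?_ ?_ ?_
  · exact fun x hx => mem_gtPatterns.2
      ((mem_gtPatterns.1 hx).isGTPattern_toggle hi (hcol x (mem_gtPatterns.1 hx)))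
  · exact fun x hx => mem_gtPatterns.2
      ((mem_gtPatterns.1 hx).isGTPattern_toggle hi (hcol x (mem_gtPatterns.1 hx)))
  · exact fun x hx => (mem_gtPatterns.1 hx).toggle_toggle hi (hcol x (mem_gtPatterns.1 hx))
  · exact fun x hx => (mem_gtPatterns.1 hx).toggle_toggle hi (hcol x (mem_gtPatterns.1 hx))
  · intro x hx
    have hx := mem_gtPatterns.1 hx
    have h0 : 0 ≤ β 0 := (hx.nonneg 0 0).trans (hx.le_bound 0 0)
    have h1 := hx.rowSum_toggle hi h0
    rw [hx.excess_eq_zero i le_rfl] at h1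
    have h2 := gtWeight_add_comp_swap (v := 0) hi (fun r hr => toggle_of_ne (β 0) hr x)
      (by simpa using h1)
    rw [zero_add, zero_add] at h2
    rw [h2]

theorem sum_gtWeight_comp {M : Type*} [AddCommMonoid M] {d : ℕ} (β : ℕ → ℤ)
    (F : (Fin d → ℤ) → M) (σ : Equiv.Perm (Fin d)) :
    ∑ x ∈ gtPatterns d β, F (gtWeight d x ∘ σ) = ∑ x ∈ gtPatterns d β, F (gtWeight d x) := by
  rcases d with _ | n
  · exact sum_congr rfl fun x _ => congrArg F (Subsingleton.elim _ _)
  · have hσ : σ ∈ Submonoid.closure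
        (Set.range fun i : Fin n => Equiv.swap i.castSucc i.succ) := by
      rw [Equiv.Perm.mclosure_swap_castSucc_succ]
      trivial
    induction hσ using Submonoid.closure_induction generalizing F with
    | mem τ hτ =>
      obtain ⟨i, rfl⟩ := hτ
      exact sum_gtWeight_comp_swap β F (by omega : i.1 + 1 < n + 1)
    | one => rfl
    | mul σ τ _ _ hσ hτ =>
      rw [← hτ F]
      exact hσ fun w => F (w ∘ τ)

/-- Since the Schur polynomial is symmetric, its weights may be permuted by `σ` in the term of the
alternant that belongs to `σ`. -/
theorem alternant_mul_schurPoly {d : ℕ} (v : Fin d → ℤ) (β : ℕ → ℤ) :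
    alternant v * schurPoly d β = ∑ x ∈ gtPatterns d β, alternant (v + gtWeight d x) := by
  unfold alternant
  rw [sum_comm, sum_mul]
  refine sum_congr rfl fun σ _ => ?_
  rw [schurPoly, ← sum_gtWeight_comp β (fun w => AddMonoidAlgebra.single w (1 : ℤ)) σ, mul_sum]
  refine sum_congr rfl fun x _ => ?_
  rw [AddMonoidAlgebra.single_mul_single, mul_one]
  rfl

-- At a first failure the excess is `α i - α (i + 1) + 1`, which is the difference of consecutive
-- entries of `shifted d α`. The toggle therefore transposes two entries of the exponent, and the
-- two alternants cancel.
open Classical in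
theorem alternant_shifted_mul_schurPoly {d : ℕ} {α : ℕ → ℤ} (hα : Antitone α) (β : ℕ → ℤ) :
    alternant (shifted d α) * schurPoly d β =
      ∑ x ∈ gtPatterns d β with RowDominant d α x, alternant (shifted d α + gtWeight d x) := by
  rw [alternant_mul_schurPoly,
    ← sum_filter_add_sum_filter_not (gtPatterns d β) (fun x => RowDominant d α x)]
  rw [add_eq_left]
  have hex : ∀ x (hx : x ∈ (gtPatterns d β).filter fun x => ¬ RowDominant d α x),
      ∃ y : ℕ × ℕ, IsFirstFailure d α x y.1 y.2 := by
    intro x hx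
    obtain ⟨hx, hx'⟩ := mem_filter.1 hx
    obtain ⟨C, i, h⟩ := (mem_gtPatterns.1 hx).exists_isFirstFailure hα hx'
    exact ⟨(C, i), h⟩
  choose y hy using hex
  have hmem : ∀ x hx, toggle (y x hx).1 (y x hx).2 x ∈
      (gtPatterns d β).filter fun x => ¬ RowDominant d α x := by
    intro x hx
    obtain ⟨h1, h2, -, -⟩ :=
      (mem_gtPatterns.1 (mem_filter.1 hx).1).isFirstFailure_toggle (hy x hx)
    exact mem_filter.2 ⟨mem_gtPatterns.2 h1, fun hr => (h1.rowDominant_iff hα).1 hr _ _ h2.fails⟩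
  have hcancel : ∀ x hx, alternant (shifted d α + gtWeight d x) +
      alternant (shifted d α + gtWeight d (toggle (y x hx).1 (y x hx).2 x)) = 0 := by
    intro x hx
    obtain ⟨-, -, -, h4⟩ :=
      (mem_gtPatterns.1 (mem_filter.1 hx).1).isFirstFailure_toggle (hy x hx)
    have hi := (hy x hx).fails.1
    rw [gtWeight_add_comp_swap hi (fun r hr => toggle_of_ne _ hr x), alternant_comp_swap,
      add_neg_cancel]
    · exact fun h => absurd (congrArg Fin.val h) (by simp)
    · rw [h4]
      simp only [shifted]
      push_cast
      ring
  refine sum_involution (fun x hx => toggle (y x hx).1 (y x hx).2 x) hcancel ?_ hmem ?_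
  -- At a fixed point the alternant is its own negative, hence zero because the coefficients are
  -- integers.
  · intro x hx hne heq
    have h := hcancel x hx
    rw [heq] at h
    refine hne (AddMonoidAlgebra.ext (Finsupp.ext fun u => ?_))
    have hu := congrArg (fun p => p.coeff u) h
    simp only [AddMonoidAlgebra.coeff_add, Finsupp.add_apply, AddMonoidAlgebra.coeff_zero,
      Finsupp.zero_apply] at hu ⊢
    omega
  · intro x hx
    obtain ⟨-, h2, h3, -⟩ :=
      (mem_gtPatterns.1 (mem_filter.1 hx).1).isFirstFailure_toggle (hy x hx)
    obtain ⟨e1, e2⟩ := (hy _ (hmem x hx)).unique h2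
    simp only [e1, e2, h3]

/-- Only the identity permutes a strictly decreasing tuple into a strictly decreasing one. -/
theorem coeff_alternant {d : ℕ} {u v : Fin d → ℤ} (hu : StrictAnti u) (hv : StrictAnti v) :
    (alternant v).coeff u = if v = u then 1 else 0 := by
  have hσ : ∀ σ : Equiv.Perm (Fin d), v ∘ σ = u → σ = 1 := by
    intro σ h
    have hmono : StrictMono σ := fun i j hij => by
      rw [← hv.lt_iff_gt]
      have := hu hij
      rwa [← h] at this
    have := (hmono.range_inj strictMono_id).1
      (by rw [σ.surjective.range_eq, Set.range_id])
    exact Equiv.ext fun r => congrFun this r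
  rw [alternant, AddMonoidAlgebra.coeff_sum, Finsupp.finsetSum_apply,
    sum_eq_single (1 : Equiv.Perm (Fin d))]
  · simp [AddMonoidAlgebra.coeff_single, Finsupp.single_apply]
  · intro σ _ hne
    rw [AddMonoidAlgebra.coeff_single, Finsupp.single_apply, if_neg fun h => hne (hσ σ h)]
  · simp

theorem shifted_strictAnti {d : ℕ} {v : Fin d → ℤ} (hv : Antitone v) :
    StrictAnti fun i : Fin d => v i - i := by
  intro i j hij
  have := hv hij.le
  have : (i : ℤ) < j := by exact_mod_cast hij
  simp only
  omega

theorem IsGTPattern.antitone_add_gtWeight {d : ℕ} {α β : ℕ → ℤ} {x : ℕ → ℕ → ℤ}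
    (h : IsGTPattern d β x) (hα : Antitone α) (hx : RowDominant d α x) :
    Antitone fun i : Fin d => α i + gtWeight d x i := by
  rcases d with _ | n
  · exact fun i => i.elim0
  refine Fin.antitone_iff_succ_le.2 fun i => ?_
  -- At the cut `0` all columns count, and the excess is the difference of two consecutive weights.
  have h1 := (h.rowDominant_iff hα).1 hx 0 i
  simp only [DominanceFails, not_and, not_lt] at h1
  have h1 := h1 (by omega)
  have h2 : excess (n + 1) x i (0 : ℕ) =
      rowSum (n + 1) x (i + 2) - 2 * rowSum (n + 1) x (i + 1) + rowSum (n + 1) x i := by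
    simp only [excess, rowSum, mul_sum, ← sum_sub_distrib, ← sum_add_distrib]
    refine sum_congr rfl fun j _ => ?_
    simp [posAbove_of_ge (h.nonneg _ j)]
  rw [h2] at h1
  simp only [gtWeight, Fin.val_succ, Fin.val_castSucc, add_assoc, Nat.reduceAdd]
  linarith

open Classical in
/-- The number of `α`-dominant Gelfand–Tsetlin patterns with top row `β` and weight `γ - α`. -/
noncomputable def gtCount (d : ℕ) (α β γ : ℕ → ℤ) : ℕ :=
  #{x ∈ gtPatterns d β | RowDominant d α x ∧ ∀ i : Fin d, α i + gtWeight d x i = γ i}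

theorem coeff_alternant_mul_schurPoly {d : ℕ} {α γ : ℕ → ℤ} (hα : Antitone α)
    (hγ : Antitone fun i : Fin d => γ i) (β : ℕ → ℤ) :
    (alternant (shifted d α) * schurPoly d β).coeff (shifted d γ) = gtCount d α β γ := by
  classical
  rw [alternant_shifted_mul_schurPoly hα, AddMonoidAlgebra.coeff_sum, Finsupp.finsetSum_apply,
    gtCount, ← filter_filter, card_filter, Nat.cast_sum]
  refine sum_congr rfl fun x hx => ?_
  obtain ⟨hx, hx'⟩ := mem_filter.1 hx
  have h1 : shifted d α + gtWeight d x = fun i : Fin d => α i + gtWeight d x i - i := by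
    funext i
    simp only [Pi.add_apply, shifted]
    ring
  rw [coeff_alternant (u := shifted d γ) (shifted_strictAnti hγ)]
  · rw [Nat.cast_ite, Nat.cast_one, Nat.cast_zero]
    congr 1
    rw [h1, funext_iff]
    simp only [shifted, sub_left_inj]
  · rw [h1]
    exact shifted_strictAnti ((mem_gtPatterns.1 hx).antitone_add_gtWeight hα hx')

/-! ### The bialternant formula and commutativity. -/

/-- The pattern of the tableau of shape `β` with all entries of row `i` equal to `i`. -/
def highestPattern (β : ℕ → ℤ) (i j : ℕ) : ℤ := if j < i then β j else 0

theorem isGTPattern_highestPattern {d : ℕ} {β : ℕ → ℤ} (hβ : Antitone β)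
    (hβ0 : ∀ j, d ≤ j → β j = 0) : IsGTPattern d β (highestPattern β) := by
  have hnn : ∀ j, 0 ≤ β j := fun j => by
    rw [← hβ0 (max d j) (le_max_left _ _)]
    exact hβ (le_max_right _ _)
  refine ⟨fun j => by simp [highestPattern], fun i hi j => ?_, fun i j => ?_, fun i j => ?_⟩
  · unfold highestPattern
    split_ifs with h
    · rfl
    · rw [hβ0 j (by omega)]
  · have := hnn j
    unfold highestPattern
    split_ifs <;> omega
  · have := hβ (Nat.le_succ j)
    rw [Nat.succ_eq_add_one] at this
    unfold highestPattern
    split_ifs <;> omega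

theorem rowDominant_highestPattern {d : ℕ} {β : ℕ → ℤ} (hβ : Antitone β) :
    RowDominant d 0 (highestPattern β) := by
  have hm : ∀ i j, highestPattern β (i + 1) j - highestPattern β i j = if j = i then β i else 0 := by
    intro i j
    unfold highestPattern
    by_cases h : j = i
    · subst h; simp
    · by_cases h' : j < i
      · rw [if_pos (by omega), if_pos h', if_neg h, sub_self]
      · rw [if_neg (by omega), if_neg h', if_neg h, sub_self]
  intro i _ k
  simp only [Pi.zero_apply, zero_add, hm, show i + 2 = i + 1 + 1 from rfl,
    sum_ite_eq', mem_range, add_lt_add_iff_right]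
  have := hβ (Nat.le_succ i)
  rw [Nat.succ_eq_add_one] at this
  split_ifs <;> omega

theorem IsGTPattern.eq_highestPattern {d : ℕ} {β : ℕ → ℤ} {x : ℕ → ℕ → ℤ}
    (h : IsGTPattern d β x) (hx : RowDominant d 0 x) : x = highestPattern β := by
  -- Each use of dominance lowers `i` and `k` together until the sum is empty. So no letter `i` lies
  -- in the rows before `i`, and interlacing excludes the rows after it.
  have hle : ∀ k i, k ≤ i → ∑ j ∈ range k, (x (i + 1) j - x i j) ≤ 0 := by
    intro k
    induction k with
    | zero => simp
    | succ k ih =>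
      intro i hi
      obtain ⟨i, rfl⟩ : ∃ i', i = i' + 1 := ⟨i - 1, by omega⟩
      by_cases hid : i + 1 < d
      · have h1 := hx i hid k
        simp only [Pi.zero_apply, zero_add] at h1
        exact h1.trans (ih i (by omega))
      · refine (sum_eq_zero fun j _ => ?_).le
        rw [h.top _ (by omega), h.top _ (by omega), sub_self]
  have hconst : ∀ i j, j < i → x (i + 1) j = x i j := by
    intro i j hj
    have h0 : ∀ l ∈ range i, 0 ≤ x (i + 1) l - x i l := fun l _ => sub_nonneg.2 (h.le_succ i l)
    have h1 := (sum_eq_zero_iff_of_nonneg h0).1 (le_antisymm (hle i i le_rfl) (sum_nonneg h0)) j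
      (mem_range.2 hj)
    exact sub_eq_zero.1 h1
  funext i j
  unfold highestPattern
  split_ifs with hj
  · have h2 : ∀ n, x (i + n) j = x i j := by
      intro n
      induction n with
      | zero => rfl
      | succ n ih => rw [← add_assoc, hconst _ _ (by omega), ih]
    rw [← h2 d, h.top _ (by omega)]
  · exact h.eq_zero (not_lt.1 hj)

theorem gtWeight_highestPattern {d : ℕ} (β : ℕ → ℤ) (i : Fin d) :
    gtWeight d (highestPattern β) i = β i := by
  have hm : ∀ j, highestPattern β (i + 1) j - highestPattern β i j =
      if j = i then β i else 0 := by
    intro j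
    unfold highestPattern
    by_cases h : j = i
    · subst h; simp
    · by_cases h' : j < i
      · rw [if_pos (by omega), if_pos h', if_neg h, sub_self]
      · rw [if_neg (by omega), if_neg h', if_neg h, sub_self]
  rw [gtWeight, rowSum, rowSum, ← sum_sub_distrib, sum_congr rfl fun j _ => hm j, sum_ite_eq',
    if_pos (mem_range.2 i.2)]

/-- For `α = 0` only the highest pattern is dominant, and its weight is `β`. -/
theorem alternant_zero_mul_schurPoly {d : ℕ} {β : ℕ → ℤ} (hβ : Antitone β)
    (hβ0 : ∀ j, d ≤ j → β j = 0) :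
    alternant (shifted d 0) * schurPoly d β = alternant (shifted d β) := by
  classical
  rw [alternant_shifted_mul_schurPoly (α := 0) antitone_const, sum_eq_single (highestPattern β)]
  · congr 1
    funext i
    simp only [Pi.add_apply, gtWeight_highestPattern, shifted, Pi.zero_apply]
    ring
  · intro x hx hne
    obtain ⟨hx, hx'⟩ := mem_filter.1 hx
    exact absurd ((mem_gtPatterns.1 hx).eq_highestPattern hx') hne
  · intro hn
    exact absurd (mem_filter.2 ⟨mem_gtPatterns.2 (isGTPattern_highestPattern hβ hβ0),
      rowDominant_highestPattern hβ⟩) hn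

/-- Both sides are the coefficient at `shifted d γ` of the product of `alternant (shifted d 0)` with
the two Schur polynomials. -/
theorem gtCount_comm {d : ℕ} {α β γ : ℕ → ℤ} (hα : Antitone α) (hα0 : ∀ j, d ≤ j → α j = 0)
    (hβ : Antitone β) (hβ0 : ∀ j, d ≤ j → β j = 0) (hγ : Antitone fun i : Fin d => γ i) :
    gtCount d α β γ = gtCount d β α γ := by
  have h := coeff_alternant_mul_schurPoly hα hγ β
  rw [← alternant_zero_mul_schurPoly hα hα0, mul_right_comm, alternant_zero_mul_schurPoly hβ hβ0,
    coeff_alternant_mul_schurPoly hβ hγ] at h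
  exact_mod_cast h.symm

/-- Dominant Gelfand–Tsetlin patterns of given weight, as a predicate. -/
structure IsLRPattern (d : ℕ) (α β γ : ℕ → ℤ) (x : ℕ → ℕ → ℤ) : Prop where
  pattern : IsGTPattern d β x
  dominant : RowDominant d α x
  weight : ∀ i : Fin d, α i + gtWeight d x i = γ i

theorem gtCount_eq_card (d : ℕ) (α β γ : ℕ → ℤ) :
    gtCount d α β γ = Nat.card {x // IsLRPattern d α β γ x} := by
  classical
  rw [gtCount, Nat.subtype_card]
  intro x
  simp only [mem_filter, mem_gtPatterns]
  exact ⟨fun h => ⟨h.1, h.2.1, h.2.2⟩, fun h => ⟨h.1, h.2, h.3⟩⟩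

/-! ### Hives and their reflection. -/

/-- Hives of size `d`: triangular arrays satisfying the three families of rhombus inequalities, with
boundary differences `α` (left side), `β` (bottom) and `γ` (diagonal). -/
structure IsHive (d : ℕ) (α β γ : ℕ → ℤ) (H : ℕ → ℕ → ℤ) : Prop where
  supp : ∀ i j, ¬ (j ≤ i ∧ i ≤ d) → H i j = 0
  left : ∀ i ≤ d, H i 0 = ∑ r ∈ range i, α r
  bottom : ∀ j ≤ d, H d j = ∑ r ∈ range d, α r + ∑ r ∈ range j, β r
  diag : ∀ i ≤ d, H i i = ∑ r ∈ range i, γ r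
  rhombus_nonneg : ∀ i j, j + 1 ≤ i → i + 1 ≤ d →
    H i (j + 1) - H i j ≤ H (i + 1) (j + 1) - H (i + 1) j
  rhombus_interlace : ∀ i j, j + 1 ≤ i → i + 1 ≤ d →
    H (i + 1) (j + 2) - H (i + 1) (j + 1) ≤ H i (j + 1) - H i j
  rhombus_dominant : ∀ i k, k ≤ i → i + 1 < d →
    H (i + 2) (k + 1) - H (i + 1) (k + 1) ≤ H (i + 1) k - H i k

/-- The hive of a pattern: partial sums of its rows, added to the partial sums of `α`. -/
def hiveOfPattern (d : ℕ) (α : ℕ → ℤ) (x : ℕ → ℕ → ℤ) (i j : ℕ) : ℤ :=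
  if j ≤ i ∧ i ≤ d then ∑ r ∈ range i, α r + ∑ l ∈ range j, x i l else 0

/-- The pattern of a hive: the differences along its rows. -/
def patternOfHive (d : ℕ) (β : ℕ → ℤ) (H : ℕ → ℕ → ℤ) (i j : ℕ) : ℤ :=
  if d ≤ i then β j else if j < i then H i (j + 1) - H i j else 0

section

variable {d : ℕ} {α β γ : ℕ → ℤ}

/-- The two interlacing inequalities and dominance become the three rhombus families; the weight
becomes the diagonal side. -/
theorem IsLRPattern.isHive {x : ℕ → ℕ → ℤ} (h : IsLRPattern d α β γ x) :
    IsHive d α β γ (hiveOfPattern d α x) := by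
  have e : ∀ {i j}, j ≤ i → i ≤ d →
      hiveOfPattern d α x i j = ∑ r ∈ range i, α r + ∑ l ∈ range j, x i l :=
    fun h1 h2 => if_pos ⟨h1, h2⟩
  refine ⟨fun i j hij => if_neg hij, fun i hi => ?_, fun j hj => ?_, fun i hi => ?_,
    fun i j hji hi => ?_, fun i j hji hi => ?_, fun i k hki hi => ?_⟩
  · rw [e (Nat.zero_le _) hi]; simp
  · rw [e hj le_rfl]
    simp only [h.pattern.top d le_rfl]
  · have h1 : ∀ i, ∑ l ∈ range i, x i l = rowSum d x i := fun i =>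
      IsGTPattern.sum_range_eq (fun j hj => h.pattern.eq_zero hj)
        fun j hj => h.pattern.eq_zero_of_le i hj
    rw [e le_rfl hi, h1]
    clear h1
    induction i with
    | zero => simp [rowSum, h.pattern.zero]
    | succ i ih =>
      have h2 := h.weight ⟨i, hi⟩
      have h3 := ih (by omega)
      simp only [gtWeight] at h2
      rw [sum_range_succ, sum_range_succ, ← h3, ← h2]
      ring
  · rw [e hji (by omega), e (by omega) (by omega), e (by omega) hi, e (by omega) hi,
      sum_range_succ (x i), sum_range_succ (x (i + 1))]
    have := h.pattern.le_succ i j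
    linarith
  · rw [e (by omega) hi, e (by omega) hi, e hji (by omega), e (by omega) (by omega),
      sum_range_succ (x (i + 1)) (j + 1), sum_range_succ (x i) j]
    have := h.pattern.succ_le i j
    linarith
  · rw [e (by omega) (by omega), e (by omega) (by omega), e (by omega) (by omega),
      e (by omega) (by omega)]
    have := h.dominant i hi k
    rw [sum_sub_distrib, sum_sub_distrib] at this
    rw [sum_range_succ α (i + 1), sum_range_succ α i]
    linarith

theorem IsHive.patternOfHive_eq {H : ℕ → ℕ → ℤ} (h : IsHive d α β γ H) {i j : ℕ} (hi : i ≤ d)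
    (hj : j < i) : patternOfHive d β H i j = H i (j + 1) - H i j := by
  unfold patternOfHive
  split_ifs with h1
  · obtain rfl : i = d := le_antisymm hi h1
    rw [h.bottom _ hj, h.bottom _ hj.le, sum_range_succ]
    ring
  · rfl

theorem patternOfHive_eq_zero {H : ℕ → ℕ → ℤ} (hβ0 : ∀ j, d ≤ j → β j = 0) {i j : ℕ}
    (hj : i ≤ j) : patternOfHive d β H i j = 0 := by
  unfold patternOfHive
  split_ifs with h1 h2
  · exact hβ0 j (by omega)
  · omega
  · rfl

theorem IsHive.sum_patternOfHive {H : ℕ → ℕ → ℤ} (h : IsHive d α β γ H) {i j : ℕ} (hi : i ≤ d)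
    (hj : j ≤ i) : ∑ l ∈ range j, patternOfHive d β H i l = H i j - H i 0 := by
  induction j with
  | zero => simp
  | succ j ih =>
    rw [sum_range_succ, ih (by omega), h.patternOfHive_eq hi hj]
    ring

theorem IsHive.isLRPattern {H : ℕ → ℕ → ℤ} (h : IsHive d α β γ H)
    (hβ : Antitone β) (hβ0 : ∀ j, d ≤ j → β j = 0) :
    IsLRPattern d α β γ (patternOfHive d β H) := by
  have hnn : ∀ j, 0 ≤ β j := fun j => by
    rw [← hβ0 (max d j) (le_max_left _ _)]
    exact hβ (le_max_right _ _)
  have htop : ∀ {i}, d ≤ i → ∀ j, patternOfHive d β H i j = β j := fun hi j => if_pos hi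
  have hz : ∀ {i j}, i ≤ j → patternOfHive d β H i j = 0 := fun hj =>
    patternOfHive_eq_zero hβ0 hj
  have hsl : ∀ i j, patternOfHive d β H (i + 1) (j + 1) ≤ patternOfHive d β H i j := by
    intro i j
    by_cases hi : d ≤ i
    · rw [htop hi, htop (by omega)]
      exact hβ (Nat.le_succ j)
    · by_cases hj : j < i
      · rw [h.patternOfHive_eq (by omega) (by omega), h.patternOfHive_eq (by omega) hj]
        exact h.rhombus_interlace i j hj (by omega)
      · rw [hz (by omega), hz (by omega)]
  -- No rhombus bounds the last entry of a row from below. Interlacing compares it with entries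
  -- further along its diagonal, which from row `d` on belong to `β` and are nonnegative.
  have hdiag : ∀ i, 0 ≤ patternOfHive d β H (i + 1) i := by
    intro i
    have h1 : ∀ n, patternOfHive d β H (i + n + 1) (i + n) ≤ patternOfHive d β H (i + 1) i := by
      intro n
      induction n with
      | zero => exact le_rfl
      | succ n ih => exact (hsl _ _).trans ih
    have h2 := h1 d
    rw [htop (by omega)] at h2
    exact (hnn _).trans h2
  have hpat : IsGTPattern d β (patternOfHive d β H) := by
    refine ⟨fun j => hz (Nat.zero_le j), fun i hi => htop hi, fun i j => ?_, hsl⟩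
    by_cases hi : d ≤ i
    · rw [htop hi, htop (by omega)]
    · rcases lt_trichotomy j i with hj | hj | hj
      · rw [h.patternOfHive_eq (by omega) hj, h.patternOfHive_eq (by omega) (by omega)]
        exact h.rhombus_nonneg i j hj (by omega)
      · subst hj
        rw [hz le_rfl]
        exact hdiag j
      · rw [hz hj.le, hz hj]
  refine ⟨hpat, fun i hi k => ?_, fun i => ?_⟩
  · have hle : ∀ k ≤ i, α (i + 1) + ∑ j ∈ range (k + 1),
        (patternOfHive d β H (i + 2) j - patternOfHive d β H (i + 1) j) ≤
        α i + ∑ j ∈ range k, (patternOfHive d β H (i + 1) j - patternOfHive d β H i j) := by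
      intro k hk
      rw [sum_sub_distrib, sum_sub_distrib, h.sum_patternOfHive (by omega) (by omega),
        h.sum_patternOfHive (by omega) (by omega), h.sum_patternOfHive (by omega) (by omega),
        h.sum_patternOfHive (by omega) (by omega), h.left _ (by omega), h.left _ (by omega),
        h.left _ (by omega), sum_range_succ α (i + 1), sum_range_succ α i]
      have := h.rhombus_dominant i k hk hi
      linarith
    rcases le_total k i with hk | hk
    · exact hle k hk
    -- Beyond `k = i` there is no rhombus; the added terms are compared by interlacing, since the
    -- entries subtracted vanish.
    · induction k, hk using Nat.le_induction with
      | base => exact hle i le_rfl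
      | succ k hk ih =>
        rw [sum_range_succ _ (k + 1),
          sum_range_succ (fun j => patternOfHive d β H (i + 1) j - patternOfHive d β H i j) k]
        have h1 : patternOfHive d β H (i + 2) (k + 1) - patternOfHive d β H (i + 1) (k + 1) ≤
            patternOfHive d β H (i + 1) k - patternOfHive d β H i k := by
          rw [hz (show i + 1 ≤ k + 1 by omega), hz hk]
          linarith [hsl (i + 1) k]
        linarith
  · have h1 : ∀ i ≤ d, rowSum d (patternOfHive d β H) i =
        ∑ r ∈ range i, γ r - ∑ r ∈ range i, α r := by
      intro i hi
      rw [rowSum, IsGTPattern.sum_range_eq (b := i) (fun j hj => hpat.eq_zero_of_le i hj)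
        (fun j hj => hz hj), h.sum_patternOfHive hi le_rfl, h.diag i hi, h.left i hi]
    rw [gtWeight, h1 _ i.2, h1 _ i.2.le, sum_range_succ, sum_range_succ]
    ring

theorem gtCount_eq_card_hives (hβ : Antitone β) (hβ0 : ∀ j, d ≤ j → β j = 0) :
    gtCount d α β γ = Nat.card {H // IsHive d α β γ H} := by
  rw [gtCount_eq_card]
  refine Nat.card_congr ⟨fun x => ⟨_, x.2.isHive⟩, fun H => ⟨_, H.2.isLRPattern hβ hβ0⟩, ?_, ?_⟩
  · rintro ⟨x, hx⟩
    ext i j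
    simp only
    by_cases hi : d ≤ i
    · rw [hx.pattern.top i hi]
      exact if_pos hi
    · by_cases hj : j < i
      · rw [hx.isHive.patternOfHive_eq (by omega) hj, hiveOfPattern, hiveOfPattern,
          if_pos ⟨hj, by omega⟩, if_pos ⟨hj.le, by omega⟩, sum_range_succ]
        ring
      · rw [patternOfHive_eq_zero hβ0 (not_lt.1 hj), hx.pattern.eq_zero (not_lt.1 hj)]
  · rintro ⟨H, hH⟩
    ext i j
    simp only [hiveOfPattern]
    split_ifs with hij
    · rw [hH.sum_patternOfHive hij.2 hij.1, hH.left i hij.2]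
      ring
    · rw [hH.supp i j hij]

/-- The reflection of a triangular array that exchanges the ends of its left side, with a linear
function added. -/
def reflectHive (d : ℕ) (k m : ℤ) (H : ℕ → ℕ → ℤ) (i j : ℕ) : ℤ :=
  if j ≤ i ∧ i ≤ d then H (d - i + j) j - H d 0 + k * i - m * j else 0

/-- The map `(i, j) ↦ (d - i + j, j)` fixes the corner `(d, d)` and swaps the bottom with the
diagonal. It exchanges the families `rhombus_nonneg` and `rhombus_dominant` and preserves
`rhombus_interlace`. Subtracting `H d 0` makes the new corner `(0, 0)` vanish. -/
theorem IsHive.isHive_reflectHive {H : ℕ → ℕ → ℤ} (h : IsHive d α β γ H) {k m : ℤ} {α' β' γ' : ℕ → ℤ}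
    (hα' : ∀ r < d, α' r = k - α (d - 1 - r)) (hβ' : ∀ r < d, β' r = γ r - m)
    (hγ' : ∀ r < d, γ' r = β r + k - m) : IsHive d α' β' γ' (reflectHive d k m H) := by
  have e : ∀ {i j}, j ≤ i → i ≤ d →
      reflectHive d k m H i j = H (d - i + j) j - H d 0 + k * i - m * j :=
    fun h1 h2 => if_pos ⟨h1, h2⟩
  have hleft : ∀ i ≤ d, reflectHive d k m H i 0 = ∑ r ∈ range i, α' r := by
    intro i hi
    rw [e (Nat.zero_le _) hi, add_zero, h.left _ (by omega), h.left _ le_rfl]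
    induction i with
    | zero => simp
    | succ i ih =>
      rw [sum_range_succ, ← ih (by omega), hα' i hi, show d - i = d - (i + 1) + 1 by omega,
        sum_range_succ, show d - (i + 1) = d - 1 - i by omega]
      push_cast
      ring
  refine ⟨fun i j hij => if_neg hij, hleft, fun j hj => ?_, fun i hi => ?_,
    fun i j hji hi => ?_, fun i j hji hi => ?_, fun i l hli hi => ?_⟩
  · rw [← hleft d le_rfl, e hj le_rfl, e (Nat.zero_le _) le_rfl,
      sum_congr rfl fun r hr => hβ' r (lt_of_lt_of_le (mem_range.1 hr) hj), sum_sub_distrib,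
      show d - d + j = j by omega, h.diag j hj, show d - d + 0 = 0 by omega,
      h.left 0 (Nat.zero_le _)]
    simp
    ring
  · rw [e le_rfl hi, show d - i + i = d by omega, h.bottom i hi, h.left d le_rfl,
      sum_congr rfl fun r hr => hγ' r (lt_of_lt_of_le (mem_range.1 hr) hi), sum_sub_distrib,
      sum_add_distrib]
    simp
    ring
  · rw [e hji (by omega), e (by omega) (by omega), e (by omega) hi, e (by omega) hi]
    have := h.rhombus_dominant (d - (i + 1) + j) j (by omega) (by omega)
    rw [show d - i + (j + 1) = d - (i + 1) + j + 2 by omega,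
      show d - i + j = d - (i + 1) + j + 1 by omega, ← add_assoc (d - (i + 1)) j 1]
    push_cast
    linarith
  · rw [e hji (by omega), e (by omega) hi, e (by omega) hi, e (by omega) (by omega)]
    have := h.rhombus_interlace (d - i + j) j (by omega) (by omega)
    rw [show d - (i + 1) + (j + 2) = d - i + j + 1 by omega,
      show d - (i + 1) + (j + 1) = d - i + j by omega, ← add_assoc (d - i) j 1]
    push_cast
    linarith
  · rw [e (by omega) (by omega), e (by omega) (by omega), e (by omega) (by omega),
      e (by omega) (by omega)]
    have := h.rhombus_nonneg (d - (i + 1) + l) l (by omega) (by omega)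
    rw [show d - (i + 2) + (l + 1) = d - (i + 1) + l by omega,
      show d - i + l = d - (i + 1) + l + 1 by omega, ← add_assoc (d - (i + 1)) l 1]
    push_cast
    linarith

/-- The second reflection carries `k * i` to `k * (d - i + j)`; the extra `k * j` is why the inverse
uses `k - m` in place of `m`. -/
theorem IsHive.reflectHive_reflectHive {H : ℕ → ℕ → ℤ} (h : IsHive d α β γ H) (k m : ℤ) :
    reflectHive d k (k - m) (reflectHive d k m H) = H := by
  funext i j
  by_cases hij : j ≤ i ∧ i ≤ d
  · obtain ⟨hj, hi⟩ := hij
    rw [reflectHive, if_pos ⟨hj, hi⟩, reflectHive, if_pos (by omega),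
      reflectHive, if_pos (by omega), show d - (d - i + j) + j = i by omega,
      show d - d + 0 = 0 by omega, h.left 0 (Nat.zero_le _), Nat.cast_add, Nat.cast_sub hi]
    simp
    ring
  · rw [h.supp i j hij]
    exact if_neg hij

theorem card_hives_reflect {k m : ℤ} {α' β' γ' : ℕ → ℤ}
    (hα' : ∀ r < d, α' r = k - α (d - 1 - r)) (hβ' : ∀ r < d, β' r = γ r - m)
    (hγ' : ∀ r < d, γ' r = β r + k - m) :
    Nat.card {H // IsHive d α β γ H} = Nat.card {H // IsHive d α' β' γ' H} := by
  refine Nat.card_congr ⟨fun H => ⟨_, H.2.isHive_reflectHive hα' hβ' hγ'⟩,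
    fun H => ⟨_, H.2.isHive_reflectHive (k := k) (m := k - m) (fun r hr => ?_) (fun r hr => ?_)
      fun r hr => ?_⟩, fun H => ?_, fun H => ?_⟩
  · rw [hα' _ (by omega), show d - 1 - (d - 1 - r) = r by omega]
    ring
  · rw [hγ' r hr]
    ring
  · rw [hβ' r hr]
    ring
  · exact Subtype.ext (H.2.reflectHive_reflectHive k m)
  · have := H.2.reflectHive_reflectHive k (k - m)
    rw [sub_sub_cancel] at this
    exact Subtype.ext this

end

/-! ### From Littlewood–Richardson tableaux to dominant patterns. -/

/-- A `d`-tuple, extended by zeros. -/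
def extendZero {d : ℕ} (K : Fin d → ℤ) (n : ℕ) : ℤ := if h : n < d then K ⟨n, h⟩ else 0

theorem extendZero_of_lt {d : ℕ} (K : Fin d → ℤ) {n : ℕ} (h : n < d) :
    extendZero K n = K ⟨n, h⟩ := dif_pos h

theorem extendZero_of_le {d : ℕ} (K : Fin d → ℤ) {n : ℕ} (h : d ≤ n) : extendZero K n = 0 :=
  dif_neg (not_lt.2 h)

theorem IsPartition.antitone_extendZero {d : ℕ} {K : Fin d → ℤ} (h : IsPartition K) :
    Antitone (extendZero K) := by
  intro a b hab
  by_cases hb : b < d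
  · rw [extendZero_of_lt K hb, extendZero_of_lt K (lt_of_le_of_lt hab hb)]
    exact h.1 hab
  · rw [extendZero_of_le K (not_lt.1 hb)]
    unfold extendZero
    split_ifs
    · exact h.2 _
    · exact le_rfl

theorem List.count_map_range_sub {f : ℤ → ℕ} (b : ℤ) (n v : ℕ) :
    ((List.range n).map fun t : ℕ => f (b - t)).count v =
      #{c ∈ Ioc (b - n) b | f c = v} := by
  induction n with
  | zero => simp
  | succ n ih =>
    have h : Ioc (b - (n + 1 : ℕ)) b = insert (b - n) (Ioc (b - n) b) := by
      ext c
      simp only [mem_Ioc, mem_insert]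
      push_cast
      omega
    rw [List.range_succ, List.map_append, List.count_append, ih, h, filter_insert]
    simp only [List.map_cons, List.map_nil]
    split_ifs with hv
    · rw [card_insert_of_notMem (by simp), hv, List.count_singleton_self]
    · rw [List.count_singleton, if_neg (by simpa using hv), add_zero]

/-- A subset of the interval `(a, b]` that is closed downwards is `(a, a + card]`. -/
theorem mem_iff_le_card_of_lower {a b : ℤ} {A : Finset ℤ} (hA : A ⊆ Ioc a b)
    (hlow : ∀ c ∈ A, ∀ c', a < c' → c' ≤ c → c' ∈ A) {c : ℤ} (hc : c ∈ Ioc a b) :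
    c ∈ A ↔ c ≤ a + #A := by
  rw [mem_Ioc] at hc
  constructor
  · intro h
    have h1 : Ioc a c ⊆ A := fun c' hc' => by
      rw [mem_Ioc] at hc'
      exact hlow c h c' hc'.1 hc'.2
    have h2 := card_le_card h1
    rw [Int.card_Ioc] at h2
    omega
  · intro h
    by_contra hn
    have h1 : A ⊆ Ioc a (c - 1) := fun c' hc' => by
      have h2 := mem_Ioc.1 (hA hc')
      rw [mem_Ioc]
      refine ⟨h2.1, ?_⟩
      by_contra h3
      exact hn (hlow c' hc' c hc.1 (by omega))
    have h2 := card_le_card h1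
    rw [Int.card_Ioc] at h2
    omega

section

variable {d : ℕ} {outer inner type : Fin d → ℤ} {T : Fin d → ℤ → ℕ}

/-- The number of letters `l + 1` in row `i` of a filling of `outer / inner`. -/
noncomputable def letterCount (outer inner : Fin d → ℤ) (T : Fin d → ℤ → ℕ) (i : Fin d) (l : ℕ) : ℕ :=
  #{c ∈ Ioc (inner i) (outer i) | T i c = l + 1}

/-- The number of letters `l + 1` in the first `i` rows of a filling. -/
noncomputable def letterPattern (outer inner : Fin d → ℤ) (T : Fin d → ℤ → ℕ) (i l : ℕ) : ℤ :=
  ∑ r ∈ range i, extendZero (fun r => (letterCount outer inner T r l : ℤ)) r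

theorem letterPattern_succ (outer inner : Fin d → ℤ) (T : Fin d → ℤ → ℕ) (i : Fin d) (l : ℕ) :
    letterPattern outer inner T (i + 1) l =
      letterPattern outer inner T i l + letterCount outer inner T i l := by
  rw [letterPattern, sum_range_succ, extendZero_of_lt _ i.2]
  rfl

theorem letterPattern_succ_of_le (outer inner : Fin d → ℤ) (T : Fin d → ℤ → ℕ) {i : ℕ} (hi : d ≤ i)
    (l : ℕ) : letterPattern outer inner T (i + 1) l = letterPattern outer inner T i l := by
  rw [letterPattern, sum_range_succ, extendZero_of_le _ hi, add_zero]
  rfl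

theorem letterPattern_of_le (outer inner : Fin d → ℤ) (T : Fin d → ℤ → ℕ) {i : ℕ} (hi : d ≤ i)
    (l : ℕ) : letterPattern outer inner T i l = letterPattern outer inner T d l := by
  induction i, hi using Nat.le_induction with
  | base => rfl
  | succ i hi ih => rw [letterPattern_succ_of_le _ _ _ hi, ih]

theorem letterPattern_le_succ (outer inner : Fin d → ℤ) (T : Fin d → ℤ → ℕ) (i l : ℕ) :
    letterPattern outer inner T i l ≤ letterPattern outer inner T (i + 1) l := by
  by_cases hi : i < d
  · rw [letterPattern_succ outer inner T ⟨i, hi⟩]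
    simp
  · rw [letterPattern_succ_of_le _ _ _ (not_lt.1 hi)]

/-- Row `i` of a filling, read from right to left. -/
def rowWord (outer inner : Fin d → ℤ) (T : Fin d → ℤ → ℕ) (i : Fin d) : List ℕ :=
  (List.range (outer i - inner i).toNat).map fun s : ℕ => T i (outer i - (s : ℤ))

/-- The first `n` rows of a filling, read as in `readingWord`. -/
def initialRows (outer inner : Fin d → ℤ) (T : Fin d → ℤ → ℕ) (n : ℕ) : List ℕ :=
  ((List.finRange d).take n).flatMap (rowWord outer inner T)

theorem initialRows_succ (outer inner : Fin d → ℤ) (T : Fin d → ℤ → ℕ) (i : Fin d) :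
    initialRows outer inner T (i + 1) =
      initialRows outer inner T i ++ rowWord outer inner T i := by
  rw [initialRows, List.take_add_one, List.flatMap_append, initialRows]
  congr 1
  rw [List.getElem?_eq_getElem (by simp)]
  simp

theorem initialRows_card (outer inner : Fin d → ℤ) (T : Fin d → ℤ → ℕ) :
    initialRows outer inner T d = readingWord outer inner T := by
  rw [initialRows, List.take_of_length_le (by simp), readingWord]
  congr 1
  funext i
  simp [rowWord, List.bind_eq_flatMap, List.map_flatMap]
  exact List.map_eq_flatMap

theorem initialRows_prefix (outer inner : Fin d → ℤ) (T : Fin d → ℤ → ℕ) (i : Fin d) :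
    initialRows outer inner T i <+: initialRows outer inner T (i + 1) := by
  rw [initialRows_succ]
  exact List.prefix_append _ _

theorem initialRows_prefix_readingWord (outer inner : Fin d → ℤ) (T : Fin d → ℤ → ℕ) {n : ℕ}
    (hn : n ≤ d) : initialRows outer inner T n <+: readingWord outer inner T := by
  rw [← initialRows_card]
  have h : ∀ k, n + k ≤ d → initialRows outer inner T n <+: initialRows outer inner T (n + k) := by
    intro k hk
    induction k with
    | zero => exact List.prefix_refl _
    | succ k ih => exact (ih (by omega)).trans (initialRows_prefix outer inner T ⟨n + k, hk⟩)
  have := h (d - n) (by omega)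
  rwa [Nat.add_sub_cancel' hn] at this

theorem count_rowWord (outer inner : Fin d → ℤ) (T : Fin d → ℤ → ℕ) (i : Fin d) (l : ℕ) :
    (rowWord outer inner T i).count (l + 1) = letterCount outer inner T i l := by
  rw [rowWord, List.count_map_range_sub, letterCount]
  congr 2
  ext c
  simp only [mem_Ioc]
  omega

theorem count_initialRows (outer inner : Fin d → ℤ) (T : Fin d → ℤ → ℕ) {n : ℕ} (hn : n ≤ d)
    (l : ℕ) : ((initialRows outer inner T n).count (l + 1) : ℤ) =
      letterPattern outer inner T n l := by
  induction n with
  | zero => simp [initialRows, letterPattern]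
  | succ n ih =>
    rw [initialRows_succ outer inner T ⟨n, hn⟩, letterPattern_succ outer inner T ⟨n, hn⟩,
      List.count_append, count_rowWord, Nat.cast_add, ih (by omega)]

theorem exists_initialRows_prefix {v : List ℕ} {n : ℕ} (hn : n ≤ d)
    (hv : v <+: initialRows outer inner T n) :
    v = [] ∨ ∃ i : Fin d, initialRows outer inner T i <+: v ∧
      v <+: initialRows outer inner T (i + 1) := by
  induction n with
  | zero => exact Or.inl (by simpa [initialRows] using hv)
  | succ n ih =>
    rcases List.prefix_or_prefix_of_prefix hv (initialRows_prefix outer inner T ⟨n, hn⟩) with h | h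
    · exact ih (by omega) h
    · exact Or.inr ⟨⟨n, hn⟩, h, hv⟩

/-- An initial part of the word ends within some row `r`. It has at most as many letters `l + 2` as
the rows through `r`, and at least as many letters `l + 1` as the rows before `r`. -/
theorem isLatticeWord_of_letterPattern (h : ∀ i l,
      letterPattern outer inner T (i + 1) (l + 1) ≤ letterPattern outer inner T i l) :
    IsLatticeWord d (readingWord outer inner T) := by
  intro v hv i hi _
  obtain ⟨l, rfl⟩ : ∃ l, i = l + 1 := ⟨i - 1, by omega⟩
  rw [← initialRows_card] at hv
  rcases exists_initialRows_prefix le_rfl hv with rfl | ⟨r, h1, h2⟩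
  · simp
  · have h3 := h1.count_le (l + 1)
    have h4 := h2.count_le (l + 1 + 1)
    have h5 := h r l
    rw [← count_initialRows (n := r + 1) _ _ _ r.2, ← count_initialRows _ _ _ r.2.le] at h5
    omega

namespace IsSkewSSYT

theorem sum_letterCount (h : IsSkewSSYT outer inner T) (i : Fin d) (k : ℕ) :
    ∑ l ∈ range k, letterCount outer inner T i l =
      #{c ∈ Ioc (inner i) (outer i) | T i c ≤ k} := by
  induction k with
  | zero =>
    rw [sum_range_zero, eq_comm, card_eq_zero, filter_eq_empty_iff]
    intro c hc
    have := (h.entries i c (mem_Ioc.1 hc)).1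
    omega
  | succ k ih =>
    rw [sum_range_succ, ih, letterCount, ← card_union_of_disjoint, ← filter_or]
    · congr 1
      refine filter_congr fun c _ => ?_
      omega
    · refine disjoint_filter.2 fun c _ h1 h2 => ?_
      omega

/-- In a weakly increasing row the entries at most `k` form an initial segment, so the letter counts
determine the row. -/
theorem entry_le_iff (h : IsSkewSSYT outer inner T) {i : Fin d} {c : ℤ} (hc : InSkew outer inner i c)
    (k : ℕ) : T i c ≤ k ↔ c ≤ inner i + (∑ l ∈ range k, letterCount outer inner T i l : ℕ) := by
  rw [h.sum_letterCount, ← mem_iff_le_card_of_lower (filter_subset _ _) _ (mem_Ioc.2 hc), mem_filter]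
  · exact ⟨fun h1 => ⟨mem_Ioc.2 hc, h1⟩, fun h1 => h1.2⟩
  · intro c₁ h1 c₂ h2 h3
    rw [mem_filter, mem_Ioc] at h1 ⊢
    exact ⟨⟨h2, h3.trans h1.1.2⟩,
      (h.row_weak i c₂ c₁ ⟨h2, h3.trans h1.1.2⟩ h1.1 h3).trans h1.2⟩

theorem letterCount_eq_zero (h : IsSkewSSYT outer inner T) (i : Fin d) {l : ℕ} (hl : d ≤ l) :
    letterCount outer inner T i l = 0 := by
  rw [letterCount, card_eq_zero, filter_eq_empty_iff]
  intro c hc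
  have := (h.entries i c (mem_Ioc.1 hc)).2
  omega

theorem letterPattern_eq_zero (h : IsSkewSSYT outer inner T) (i : ℕ) {l : ℕ} (hl : d ≤ l) :
    letterPattern outer inner T i l = 0 := by
  refine sum_eq_zero fun r _ => ?_
  unfold extendZero
  split_ifs
  · simp [h.letterCount_eq_zero _ hl]
  · rfl

/-- The lattice condition is applied to the word that stops in row `i` just before the entries at
most `l + 1`: read from the right, all letters `l + 2` of the row have then occurred and none of its
letters `l + 1`. -/
theorem letterPattern_interlace (h : IsSkewSSYT outer inner T)
    (hlat : IsLatticeWord d (readingWord outer inner T)) (i : Fin d) {l : ℕ} (hl : l + 1 < d) :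
    letterPattern outer inner T (i + 1) (l + 1) ≤ letterPattern outer inner T i l := by
  set n := ∑ l ∈ range (l + 1), letterCount outer inner T i l with hn
  set s := (outer i - inner i).toNat - n with hs
  let u : List ℕ := (List.range s).map fun t : ℕ => T i (outer i - (t : ℤ))
  have hu : u <+: rowWord outer inner T i := by
    have : List.range s = (List.range (outer i - inner i).toNat).take s := by
      rw [List.take_range, min_eq_left (by omega)]
    simp only [u, this, rowWord, List.map_take]
    exact List.take_prefix _ _
  have hpre : initialRows outer inner T i ++ u <+: readingWord outer inner T := by
    refine List.IsPrefix.trans ?_ (initialRows_prefix_readingWord outer inner T i.2)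
    rw [initialRows_succ]
    exact (List.prefix_append_right_inj _).2 hu
  have hcount := hlat _ hpre (l + 1) (by omega) (by omega)
  have hnle : n ≤ (outer i - inner i).toNat := by
    rw [hn, h.sum_letterCount, ← Int.card_Ioc]
    exact card_filter_le _ _
  have hmem : ∀ c, c ∈ Ioc (outer i - s) (outer i) ↔
      c ∈ Ioc (inner i) (outer i) ∧ ¬ T i c ≤ l + 1 := by
    intro c
    constructor
    · intro hc
      rw [mem_Ioc] at hc
      have hc' : InSkew outer inner i c := ⟨by omega, hc.2⟩
      rw [h.entry_le_iff hc', mem_Ioc]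
      exact ⟨hc', by omega⟩
    · rintro ⟨hc, hc'⟩
      rw [h.entry_le_iff (mem_Ioc.1 hc)] at hc'
      rw [mem_Ioc] at hc ⊢
      omega
  have hu1 : u.count (l + 1) = 0 := by
    rw [List.count_map_range_sub, card_eq_zero, filter_eq_empty_iff]
    intro c hc
    have := ((hmem c).1 hc).2
    omega
  have hu2 : u.count (l + 1 + 1) = letterCount outer inner T i (l + 1) := by
    rw [List.count_map_range_sub, letterCount]
    congr 1
    ext c
    rw [mem_filter, mem_filter, hmem]
    constructor
    · exact fun h => ⟨h.1.1, h.2⟩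
    · exact fun h => ⟨⟨h.1, by omega⟩, h.2⟩
  rw [List.count_append, List.count_append, hu1, hu2] at hcount
  rw [letterPattern_succ, ← count_initialRows _ _ _ i.2.le, ← count_initialRows _ _ _ i.2.le]
  omega

/-- Let `c` be the last column of row `i'` reached by entries at most `k + 1`. Either it is not
beyond `inner i`, or the box above it in row `i` lies in the diagram and, by column strictness, has
an entry at most `k`. -/
theorem column_bound (h : IsSkewSSYT outer inner T) (ho : Antitone outer) (hi : Antitone inner)
    {i i' : Fin d} (hii : i < i') (k : ℕ) :
    inner i' + (∑ l ∈ range (k + 1), letterCount outer inner T i' l : ℕ) ≤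
      inner i + (∑ l ∈ range k, letterCount outer inner T i l : ℕ) := by
  set c := inner i' + (∑ l ∈ range (k + 1), letterCount outer inner T i' l : ℕ) with hc
  by_cases hci : c ≤ inner i
  · omega
  · have hi' := hi hii.le
    have ho' := ho hii.le
    have hcard : #{c ∈ Ioc (inner i') (outer i') | T i' c ≤ k + 1} ≤
        (outer i' - inner i').toNat := by
      rw [← Int.card_Ioc]
      exact card_filter_le _ _
    rw [← h.sum_letterCount] at hcard
    have h1 : InSkew outer inner i' c := ⟨by omega, by omega⟩
    have h2 : InSkew outer inner i c := ⟨by omega, by omega⟩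
    have h3 := (h.entry_le_iff h1 (k + 1)).2 le_rfl
    have h4 := h.col_strict i i' c h2 h1 hii
    exact (h.entry_le_iff h2 k).1 (by omega)

end IsSkewSSYT

theorem IsLRTableau.isLRPattern (h : IsLRTableau outer inner type T) (ho : Antitone outer)
    (hi : Antitone inner) (ht : IsPartition type) (hio : inner ≤ outer) :
    IsLRPattern d (extendZero inner) (extendZero type) (extendZero outer)
      (letterPattern outer inner T) := by
  have htop : ∀ i, d ≤ i → ∀ l, letterPattern outer inner T i l = extendZero type l := by
    intro i hi l
    rw [letterPattern_of_le _ _ _ hi]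
    by_cases hl : l < d
    · rw [extendZero_of_lt _ hl, ← h.content ⟨l, hl⟩, ← initialRows_card,
        count_initialRows _ _ _ le_rfl]
    · rw [extendZero_of_le _ (not_lt.1 hl), h.ssyt.letterPattern_eq_zero _ (not_lt.1 hl)]
  have hnn : ∀ i l, 0 ≤ letterPattern outer inner T i l := by
    intro i l
    induction i with
    | zero => simp [letterPattern]
    | succ i ih => exact ih.trans (letterPattern_le_succ _ _ _ _ _)
  refine ⟨⟨fun j => by simp [letterPattern], htop, letterPattern_le_succ outer inner T,
    fun i l => ?_⟩, fun i hid k => ?_, fun i => ?_⟩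
  · by_cases hid : i < d
    · by_cases hl : l + 1 < d
      · exact h.ssyt.letterPattern_interlace h.lattice ⟨i, hid⟩ hl
      · rw [h.ssyt.letterPattern_eq_zero _ (not_lt.1 hl)]
        exact hnn i l
    · rw [htop _ (by omega), htop _ (by omega)]
      exact ht.antitone_extendZero (Nat.le_succ l)
  · have h1 := h.ssyt.column_bound ho hi
      (show (⟨i, by omega⟩ : Fin d) < ⟨i + 1, hid⟩ from Nat.lt_succ_self i) k
    have h2 : ∀ (r : Fin d) (l : ℕ), letterPattern outer inner T (r + 1) l -
        letterPattern outer inner T r l = letterCount outer inner T r l := fun r l => by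
      rw [letterPattern_succ]; ring
    have h3 : ∀ l ∈ range (k + 1), letterPattern outer inner T (i + 2) l -
        letterPattern outer inner T (i + 1) l = letterCount outer inner T ⟨i + 1, hid⟩ l :=
      fun l _ => h2 ⟨i + 1, hid⟩ l
    have h4 : ∀ l ∈ range k, letterPattern outer inner T (i + 1) l -
        letterPattern outer inner T i l = letterCount outer inner T ⟨i, by omega⟩ l :=
      fun l _ => h2 ⟨i, by omega⟩ l
    rw [sum_congr rfl h3, sum_congr rfl h4, extendZero_of_lt _ hid, extendZero_of_lt _ (by omega)]
    exact_mod_cast h1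
  · have h1 : gtWeight d (letterPattern outer inner T) i =
        (∑ l ∈ range d, letterCount outer inner T i l : ℕ) := by
      rw [gtWeight, rowSum, rowSum, ← sum_sub_distrib, Nat.cast_sum]
      refine sum_congr rfl fun l _ => ?_
      rw [letterPattern_succ]
      ring
    have h2 : #{c ∈ Ioc (inner i) (outer i) | T i c ≤ d} = (outer i - inner i).toNat := by
      rw [filter_true_of_mem fun c hc => (h.ssyt.entries i c (mem_Ioc.1 hc)).2, Int.card_Ioc]
    have h3 : inner i ≤ outer i := hio i
    rw [h1, h.ssyt.sum_letterCount, h2, extendZero_of_lt _ i.2, extendZero_of_lt _ i.2]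
    simp only [Fin.eta]
    omega

theorem IsSkewSSYT.eq_of_letterPattern_eq {T' : Fin d → ℤ → ℕ} (h : IsSkewSSYT outer inner T)
    (h' : IsSkewSSYT outer inner T')
    (he : letterPattern outer inner T = letterPattern outer inner T') : T = T' := by
  have hc : letterCount outer inner T = letterCount outer inner T' := by
    funext i l
    have h1 := letterPattern_succ outer inner T i l
    have h2 := letterPattern_succ outer inner T' i l
    rw [he] at h1
    omega
  funext i c
  by_cases hic : InSkew outer inner i c
  · refine eq_of_forall_ge_iff fun k => ?_
    rw [h.entry_le_iff hic, h'.entry_le_iff hic, hc]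
  · rw [h.zeros i c hic, h'.zeros i c hic]

end

/-! ### From dominant patterns back to tableaux, and the conclusion. -/

section

variable {d : ℕ} {outer inner type : Fin d → ℤ} {x : ℕ → ℕ → ℤ}

/-- The last column of row `i` with an entry at most `k` in the tableau of the pattern `x`. -/
def columnBound (inner : Fin d → ℤ) (x : ℕ → ℕ → ℤ) (i : Fin d) (k : ℕ) : ℤ :=
  inner i + ∑ l ∈ range k, (x (i + 1) l - x i l)

open Classical in
/-- The filling of `outer / inner` in which row `i` has `x (i + 1) l - x i l` letters `l + 1`. -/
noncomputable def tableauOfPattern (outer inner : Fin d → ℤ) (x : ℕ → ℕ → ℤ) (i : Fin d) (c : ℤ) :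
    ℕ :=
  if InSkew outer inner i c then sInf {k | c ≤ columnBound inner x i k} else 0

theorem columnBound_succ (inner : Fin d → ℤ) (x : ℕ → ℕ → ℤ) (i : Fin d) (k : ℕ) :
    columnBound inner x i (k + 1) = columnBound inner x i k + (x (i + 1) k - x i k) := by
  rw [columnBound, sum_range_succ, columnBound]
  ring

namespace IsLRPattern

theorem columnBound_mono (h : IsLRPattern d (extendZero inner) (extendZero type) (extendZero outer) x)
    (i : Fin d) : Monotone (columnBound inner x i) :=
  monotone_nat_of_le_succ fun k => by
    rw [columnBound_succ]
    linarith [h.pattern.le_succ i k]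

theorem columnBound_card
    (h : IsLRPattern d (extendZero inner) (extendZero type) (extendZero outer) x) (i : Fin d) :
    columnBound inner x i d = outer i := by
  have := h.weight i
  rw [extendZero_of_lt _ i.2, extendZero_of_lt _ i.2, gtWeight, rowSum, rowSum,
    ← sum_sub_distrib] at this
  exact this

theorem columnBound_le
    (h : IsLRPattern d (extendZero inner) (extendZero type) (extendZero outer) x) (i : Fin d) (k : ℕ) :
    columnBound inner x i k ≤ outer i := by
  rcases le_total k d with hk | hk
  · rw [← h.columnBound_card i]
    exact h.columnBound_mono i hk
  · refine le_of_eq ?_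
    rw [← h.columnBound_card i, columnBound, columnBound,
      IsGTPattern.sum_range_eq (b := d) (fun j hj => ?_) fun j hj => ?_]
    · rw [h.pattern.eq_zero_of_le _ (hk.trans hj), h.pattern.eq_zero_of_le _ (hk.trans hj), sub_self]
    · rw [h.pattern.eq_zero_of_le _ hj, h.pattern.eq_zero_of_le _ hj, sub_self]

theorem inner_le_columnBound
    (h : IsLRPattern d (extendZero inner) (extendZero type) (extendZero outer) x) (i : Fin d) (k : ℕ) :
    inner i ≤ columnBound inner x i k := by
  have := h.columnBound_mono i (Nat.zero_le k)
  simpa [columnBound] using this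

theorem inner_le_outer
    (h : IsLRPattern d (extendZero inner) (extendZero type) (extendZero outer) x) : inner ≤ outer :=
  fun i => (h.inner_le_columnBound i d).trans (h.columnBound_le i d)

/-- Dominance is this inequality for adjacent rows; monotonicity in `k` chains it to distant ones.
It yields column strictness. -/
theorem columnBound_row
    (h : IsLRPattern d (extendZero inner) (extendZero type) (extendZero outer) x) {i i' : Fin d}
    (hii : i < i') (k : ℕ) : columnBound inner x i' (k + 1) ≤ columnBound inner x i k := by
  obtain ⟨i, hi⟩ := i
  obtain ⟨i', hi'⟩ := i'
  replace hii : i < i' := hii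
  have hstep : ∀ n (hn : n + 1 < d),
      columnBound inner x ⟨n + 1, hn⟩ (k + 1) ≤ columnBound inner x ⟨n, by omega⟩ k := by
    intro n hn
    have := h.dominant n hn k
    rw [extendZero_of_lt _ hn, extendZero_of_lt _ (by omega)] at this
    exact this
  induction i', hii using Nat.le_induction with
  | base => exact hstep i hi'
  | succ n hn ih =>
    exact (hstep n hi').trans
      ((h.columnBound_mono _ (Nat.le_succ k)).trans (ih (by omega) hstep))

theorem tableauOfPattern_le_iff
    (h : IsLRPattern d (extendZero inner) (extendZero type) (extendZero outer) x) {i : Fin d} {c : ℤ}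
    (hc : InSkew outer inner i c) (k : ℕ) :
    tableauOfPattern outer inner x i c ≤ k ↔ c ≤ columnBound inner x i k := by
  rw [tableauOfPattern, if_pos hc]
  have hne : {k | c ≤ columnBound inner x i k}.Nonempty :=
    ⟨d, hc.2.trans (h.columnBound_card i).ge⟩
  exact ⟨fun hk => (Nat.sInf_mem hne).trans (h.columnBound_mono i hk), fun hk => Nat.sInf_le hk⟩

theorem isSkewSSYT (h : IsLRPattern d (extendZero inner) (extendZero type) (extendZero outer) x) :
    IsSkewSSYT outer inner (tableauOfPattern outer inner x) where
  zeros i j hij := if_neg hij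
  entries i j hij := by
    refine ⟨?_, (h.tableauOfPattern_le_iff hij d).2 (hij.2.trans (h.columnBound_card i).ge)⟩
    by_contra hn
    have := (h.tableauOfPattern_le_iff hij 0).1 (by omega)
    simp only [columnBound, range_zero, sum_empty, add_zero] at this
    exact absurd hij.1 (not_lt.2 this)
  row_weak i j j' hj hj' hle :=
    (h.tableauOfPattern_le_iff hj _).2 (hle.trans ((h.tableauOfPattern_le_iff hj' _).1 le_rfl))
  col_strict i i' j hj hj' hii := by
    have h1 := (h.tableauOfPattern_le_iff hj' _).1 le_rfl
    rcases hk : tableauOfPattern outer inner x i' j with _ | k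
    · rw [hk] at h1
      simp only [columnBound, range_zero, sum_empty, add_zero] at h1
      exact absurd hj'.1 (not_lt.2 h1)
    · rw [hk] at h1
      exact Nat.lt_succ_of_le
        ((h.tableauOfPattern_le_iff hj k).2 (h1.trans (h.columnBound_row hii k)))

theorem letterCount_tableauOfPattern
    (h : IsLRPattern d (extendZero inner) (extendZero type) (extendZero outer) x) (i : Fin d) (l : ℕ) :
    (letterCount outer inner (tableauOfPattern outer inner x) i l : ℤ) = x (i + 1) l - x i l := by
  have h1 : ({c ∈ Ioc (inner i) (outer i) | tableauOfPattern outer inner x i c = l + 1}) =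
      Ioc (columnBound inner x i l) (columnBound inner x i (l + 1)) := by
    ext c
    have h2 := h.inner_le_columnBound i l
    have h3 := h.columnBound_le i (l + 1)
    rw [mem_filter, mem_Ioc, mem_Ioc]
    constructor
    · rintro ⟨hc, he⟩
      have h4 := h.tableauOfPattern_le_iff hc l
      have h5 := h.tableauOfPattern_le_iff hc (l + 1)
      omega
    · rintro ⟨hc, hc'⟩
      have hcs : InSkew outer inner i c := ⟨by omega, by omega⟩
      have h4 := h.tableauOfPattern_le_iff hcs l
      have h5 := h.tableauOfPattern_le_iff hcs (l + 1)
      exact ⟨hcs, by omega⟩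
  have h6 := h.pattern.le_succ i l
  rw [letterCount, h1, Int.card_Ioc, columnBound_succ]
  omega

theorem letterPattern_tableauOfPattern
    (h : IsLRPattern d (extendZero inner) (extendZero type) (extendZero outer) x) :
    letterPattern outer inner (tableauOfPattern outer inner x) = x := by
  funext i l
  induction i with
  | zero => simp [letterPattern, h.pattern.zero]
  | succ i ih =>
    by_cases hi : i < d
    · rw [letterPattern_succ _ _ _ ⟨i, hi⟩, h.letterCount_tableauOfPattern, ih]
      ring
    · rw [letterPattern_succ_of_le _ _ _ (not_lt.1 hi), ih, h.pattern.top _ (not_lt.1 hi),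
        h.pattern.top _ (by omega)]

theorem isLRTableau (h : IsLRPattern d (extendZero inner) (extendZero type) (extendZero outer) x) :
    IsLRTableau outer inner type (tableauOfPattern outer inner x) where
  ssyt := h.isSkewSSYT
  content i := by
    rw [← initialRows_card, count_initialRows _ _ _ le_rfl, h.letterPattern_tableauOfPattern,
      h.pattern.top d le_rfl, extendZero_of_lt _ i.2]
  lattice := isLatticeWord_of_letterPattern fun i l => by
    rw [h.letterPattern_tableauOfPattern]
    exact h.pattern.succ_le i l

end IsLRPattern

/-- Littlewood–Richardson numbers count dominant Gelfand–Tsetlin patterns. -/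
theorem lrNumber_eq_gtCount (hi : IsPartition inner) (ht : IsPartition type)
    (ho : Antitone outer) : lrNumber inner type outer =
      gtCount d (extendZero inner) (extendZero type) (extendZero outer) := by
  rw [gtCount_eq_card, lrNumber]
  split_ifs with h
  · refine Nat.card_congr (Equiv.ofBijective
      (fun T => ⟨_, T.2.isLRPattern ho hi.1 ht h.2.2.2⟩) ⟨fun T T' hT => ?_, fun x => ?_⟩)
    · exact Subtype.ext (T.2.ssyt.eq_of_letterPattern_eq T'.2.ssyt (congrArg Subtype.val hT))
    · exact ⟨⟨_, x.2.isLRTableau⟩, Subtype.ext x.2.letterPattern_tableauOfPattern⟩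
  -- A pattern forces `inner ≤ outer`, hence `0 ≤ outer`. So when the side conditions of `lrNumber`
  -- fail there is no pattern, and both counts are zero.
  · refine (Nat.card_eq_zero.2 (Or.inl ⟨fun x => h ?_⟩)).symm
    have hio := x.2.inner_le_outer
    exact ⟨⟨ho, fun i => (hi.2 i).trans (hio i)⟩, hi, ht, hio⟩

end

theorem mainTheorem7 (d : ℕ) (α β γ : Fin d → ℤ)
    (hα : IsPartition α) (hβ : IsPartition β) (hγ : IsPartition γ)
    (k m : ℕ) (hk : β ≤ rect d k) (hm : rect d m ≤ γ) :
    lrNumber α β γ =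
      lrNumber (rect d k - revTuple β) (γ - rect d m) (α + rect d k - rect d m) := by
  have hinner : IsPartition (rect d k - revTuple β) :=
    ⟨fun i j hij => sub_le_sub_left (hβ.1 (Fin.rev_le_rev.2 hij)) _,
      fun i => sub_nonneg.2 (hk (Fin.rev i))⟩
  have htype : IsPartition (γ - rect d m) :=
    ⟨fun i j hij => sub_le_sub_right (hγ.1 hij) _, fun i => sub_nonneg.2 (hm i)⟩
  -- This tuple may have negative entries, so only its monotonicity is available.
  have houter : Antitone (α + rect d k - rect d m) := fun i j hij =>
    sub_le_sub_right (add_le_add_left (hα.1 hij) _) _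
  have hγ' : Antitone fun i : Fin d => extendZero γ i := fun i j hij =>
    hγ.antitone_extendZero hij
  -- The exchange of `α` and `β` puts `β` on the left side of the hive, the side that the reflection
  -- reverses.
  rw [lrNumber_eq_gtCount hα hβ hγ.1, lrNumber_eq_gtCount hinner htype houter,
    gtCount_comm hα.antitone_extendZero (fun _ => extendZero_of_le α) hβ.antitone_extendZero
      (fun _ => extendZero_of_le β) hγ',
    gtCount_eq_card_hives hα.antitone_extendZero (fun _ => extendZero_of_le α),
    gtCount_eq_card_hives htype.antitone_extendZero (fun _ => extendZero_of_le _)]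
  refine card_hives_reflect (k := k) (m := m) (fun r hr => ?_) (fun r hr => ?_) fun r hr => ?_
  · rw [extendZero_of_lt _ hr, extendZero_of_lt _ (show d - 1 - r < d by omega)]
    simp only [Pi.sub_apply, rect, revTuple, sub_right_inj]
    congr 1
    ext
    simp only [Fin.val_rev]
    omega
  · rw [extendZero_of_lt _ hr, extendZero_of_lt _ hr]
    rfl
  · rw [extendZero_of_lt _ hr, extendZero_of_lt _ hr]
    rfl
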